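/- Let $q$ be a prime power, let $d\ge 5$ be odd, and let $V$ be a vector space of dimension $2d$ over the field $\mathbb F_{q^2}$, equipped with a nondegenerate hermitian form $h$ (with respect to the involution $x\mapsto x^q$ of $\mathbb F_{q^2}$). A generator of the hermitian polar space $H(2d-1,q^2)$ defined by $h$ is a maximal totally isotropic subspace of $V$. Let $S$ be an Erdős–Ko–Rado set of generators of $H(2d-1,q^2)$, that is, a set of generators any two of which intersect in a non-zero subspace. Then $$|S|\le \bigl((q^2+q+1)q^{2d-3}+1\bigr)\prod_{\substack{1\le i\le d-1\\ 2i\ne d\pm1}}\bigl(q^{2i-1}+1\bigr),$$ where the product omits the two indices $i=(d-1)/2$ and $i=(d+1)/2$. -/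

import Mathlib

/-- `h` is a nondegenerate hermitian form on `V` over the field `K`, where `σ` is the
automorphism `x ↦ x ^ q` of `K` (for `K` of order `q ^ 2` this is the involution of `K`):
`h` is `σ`-semilinear in the first and linear in the second argument, `σ (h x y) = h y x`,
and only `0` is orthogonal to all vectors. -/
structure IsHermitianPolarForm {K V : Type*} [Field K] [AddCommGroup V] [Module K V]
    {σ : K →+* K} (q : ℕ) (h : V →ₛₗ[σ] V →ₗ[K] K) : Prop where
  conj : ∀ a : K, σ a = a ^ q
  hermitian : h.IsSymm
  nondegenerate : h.Nondegenerate

/-- A subspace is totally isotropic if the form vanishes identically on it. These are the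
subspaces of the polar space of `h`. -/
def IsTotallyIsotropic {K V : Type*} [Field K] [AddCommGroup V] [Module K V]
    {σ : K →+* K} (h : V →ₛₗ[σ] V →ₗ[K] K) (W : Submodule K V) : Prop :=
  ∀ x ∈ W, ∀ y ∈ W, h x y = 0

/-- A generator of the polar space of `h` is a totally isotropic subspace that is maximal
with respect to inclusion. -/
def IsGenerator {K V : Type*} [Field K] [AddCommGroup V] [Module K V]
    {σ : K →+* K} (h : V →ₛₗ[σ] V →ₗ[K] K) (G : Submodule K V) : Prop :=
  Maximal (IsTotallyIsotropic h) G

/-- An Erdős–Ko–Rado set of generators: a set of generators of the polar space of `h`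
that mutually intersect in more than the zero vector. -/
def IsErdosKoRadoSet {K V : Type*} [Field K] [AddCommGroup V] [Module K V]
    {σ : K →+* K} (h : V →ₛₗ[σ] V →ₗ[K] K) (S : Set (Submodule K V)) : Prop :=
  (∀ G ∈ S, IsGenerator h G) ∧ S.Pairwise (fun G H => G ⊓ H ≠ ⊥)

/-! The proof is a weighted Hoffman (ratio) bound. Let `A_c` be the 0-1 matrix of the relation
"meeting in dimension `c`" on generators, `J` the all-ones matrix, and consider `A_0 - f A_2` with a
weight `f ≥ 0`. If `M = A_0 - f A_2 + Λ I - β J` is positive semidefinite, evaluate its form at the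
indicator vector of `S`: there `A_0` contributes nothing and `-f A_2` contributes at most zero, so
`0 ≤ Λ |S| - β |S|^2` and `β |S| ≤ Λ`.

Positivity is read off a triangular action instead of an eigenspace decomposition. The indicators of
the generators through isotropic subspaces of dimension below `r` span a filtration of the function
space (`pencilSpan`). If a symmetric matrix acts on the `r`-th layer as a scalar `ν r`, every
eigenvalue is one of these scalars (`posSemidef_of_isTriangular`). For `A_0` the scalar is, up to a
power of `q`, a Möbius coefficient of the subspace lattice (`disjointFun_sub_mem`). The matrix `B`
counting common hyperplanes, which is the dual polar graph up to a multiple of the identity, is also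
triangular. The three-term recurrence for `B A_c` then expresses `A_1` and `A_2` through `B` and
`A_0`, so `A_2` is triangular too (`meetMatrix_two_isTriangular`).

For odd `d`, `A_0` has negative scalars at both `r = 1` and `r = d`. The weight `f` is chosen so
that those of `A_0 - f A_2` coincide, with common value `-Λ`; for `1 < r < d` crude estimates show
that the scalar is at least `-Λ` (`diagonal_ge`, which needs `d ≥ 5`). Finally `β` is chosen so that
the scalar of `M` at `r = 0` vanishes, and `Λ / β` is the asserted bound by the identity
`one_sub_lineWeight_mul_zero`. -/

namespace HermitianPolar

open Module

set_option linter.unusedSectionVars false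

/-! ### Hermitian forms over finite fields: orthogonality, traces and norms -/

section Form

variable {K V : Type*} [Field K] [AddCommGroup V] [Module K V] {σ : K →+* K}

/-- The standing assumptions: `h` is a nondegenerate hermitian form on a space of dimension
`2 * d` over the field of order `q ^ 2`. -/
structure HermitianSpace (q d : ℕ) (h : V →ₛₗ[σ] V →ₗ[K] K) : Prop where
  card_eq : Nat.card K = q ^ 2
  finrank_eq : finrank K V = 2 * d
  form : IsHermitianPolarForm q h

/-- The subspace of vectors orthogonal to `W`. -/
abbrev perp (h : V →ₛₗ[σ] V →ₗ[K] K) (W : Submodule K V) : Submodule K V :=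
  W.orthogonalBilin h

theorem mem_perp {h : V →ₛₗ[σ] V →ₗ[K] K} {W : Submodule K V} {v : V} :
    v ∈ perp h W ↔ ∀ w ∈ W, h w v = 0 := Iff.rfl

theorem perp_anti {h : V →ₛₗ[σ] V →ₗ[K] K} {A B : Submodule K V} (hAB : A ≤ B) :
    perp h B ≤ perp h A := fun _ hv w hw => hv w (hAB hw)

theorem isTotallyIsotropic_iff_le_perp {h : V →ₛₗ[σ] V →ₗ[K] K} {W : Submodule K V} :
    IsTotallyIsotropic h W ↔ W ≤ perp h W :=
  ⟨fun hW v hv w hw => hW w hw v hv, fun hW x hx _ hy => hW hy x hx⟩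

theorem perp_sup (h : V →ₛₗ[σ] V →ₗ[K] K) (A B : Submodule K V) :
    perp h (A ⊔ B) = perp h A ⊓ perp h B := by
  apply le_antisymm
  · exact le_inf (perp_anti le_sup_left) (perp_anti le_sup_right)
  · rintro v ⟨hA, hB⟩ w hw
    obtain ⟨a, ha, b, hb, rfl⟩ := Submodule.mem_sup.1 hw
    simp [mem_perp.1 hA a ha, mem_perp.1 hB b hb]

namespace HermitianSpace

variable {q d : ℕ} {h : V →ₛₗ[σ] V →ₗ[K] K}

theorem symm (H : HermitianSpace q d h) (x y : V) : σ (h x y) = h y x :=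
  H.form.hermitian.eq x y

theorem ortho_comm (H : HermitianSpace q d h) {x y : V} : h x y = 0 ↔ h y x = 0 := by
  rw [← H.symm x y, map_eq_zero σ]

theorem sigma_sigma (H : HermitianSpace q d h) [Finite K] (a : K) : σ (σ a) = a := by
  have := Fintype.ofFinite K
  rw [H.form.conj, H.form.conj, ← pow_mul, ← pow_two, ← H.card_eq, Nat.card_eq_fintype_card,
    FiniteField.pow_card]

theorem one_lt (H : HermitianSpace q d h) [Finite K] : 1 < q := by
  have h1 : 1 < Nat.card K := Finite.one_lt_card
  rw [H.card_eq] at h1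
  by_contra hq
  interval_cases q <;> simp at h1

theorem le_perp_comm (H : HermitianSpace q d h) {A B : Submodule K V} :
    A ≤ perp h B ↔ B ≤ perp h A :=
  ⟨fun hA _ hb _ ha => H.ortho_comm.1 (hA ha _ hb),
    fun hB _ ha _ hb => H.ortho_comm.1 (hB hb _ ha)⟩

theorem isTotallyIsotropic_sup (H : HermitianSpace q d h) {A B : Submodule K V}
    (hA : IsTotallyIsotropic h A) (hB : IsTotallyIsotropic h B) (hAB : A ≤ perp h B) :
    IsTotallyIsotropic h (A ⊔ B) := by
  rw [isTotallyIsotropic_iff_le_perp] at *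
  rw [perp_sup]
  exact le_inf (sup_le hA (H.le_perp_comm.1 hAB)) (sup_le hAB hB)

variable [Finite K]

theorem card_fixed_le (H : HermitianSpace q d h) : Nat.card {c : K // c ^ q = c} ≤ q := by
  classical
  have := Fintype.ofFinite K
  have hq := H.one_lt
  rw [Nat.card_eq_fintype_card, Fintype.card_subtype]
  have hsub : (Finset.univ.filter fun c : K => c ^ q = c) ⊆
      ((Polynomial.X ^ q - Polynomial.X : Polynomial K).roots).toFinset := by
    intro c hc
    rw [Multiset.mem_toFinset, Polynomial.mem_roots (FiniteField.X_pow_card_sub_X_ne_zero K hq)]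
    simpa [sub_eq_zero] using hc
  refine (Finset.card_le_card hsub).trans ((Multiset.toFinset_card_le _).trans
    ((Polynomial.card_roots' _).trans ?_))
  rw [FiniteField.X_pow_card_sub_X_natDegree_eq K hq]

/-- Every element fixed by the involution is the trace of exactly `q` elements. -/
theorem card_trace_eq (H : HermitianSpace q d h) {c : K} (hc : σ c = c) :
    Nat.card {a : K // a + σ a = c} = q := by
  classical
  have := Fintype.ofFinite K
  have hq := H.one_lt
  let T : K →+ K := AddMonoidHom.id K + σ.toAddMonoidHom
  have hT : ∀ a, T a = a + σ a := fun a => rfl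
  have hker : Nat.card T.ker ≤ q := by
    rw [← SetLike.coe_sort_coe, Nat.card_coe_set_eq, Set.ncard_eq_toFinset_card']
    have hne : (Polynomial.X ^ q + Polynomial.X : Polynomial K).natDegree = q := by
      compute_degree!
      · rw [if_neg (by omega)]; simp
      · omega
    have hne0 : (Polynomial.X ^ q + Polynomial.X : Polynomial K) ≠ 0 := by
      intro h0
      rw [h0] at hne
      simp at hne
      omega
    have hsub : (T.ker : Set K).toFinset ⊆
        ((Polynomial.X ^ q + Polynomial.X : Polynomial K).roots).toFinset := by
      intro a ha
      rw [Multiset.mem_toFinset, Polynomial.mem_roots hne0]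
      have : a + σ a = 0 := by simpa [hT, AddMonoidHom.mem_ker] using ha
      rw [H.form.conj] at this
      simpa [add_comm] using this
    refine (Finset.card_le_card hsub).trans ((Multiset.toFinset_card_le _).trans
      ((Polynomial.card_roots' _).trans hne.le))
  have hran : ∀ a ∈ T.range, a ^ q = a := by
    rintro _ ⟨a, rfl⟩
    rw [← H.form.conj, hT, map_add, H.sigma_sigma, add_comm]
  have hrle : Nat.card T.range ≤ Nat.card {c : K // c ^ q = c} :=
    Nat.card_le_card_of_injective (fun a : T.range => (⟨a, hran a a.2⟩ : {c : K // c ^ q = c}))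
      fun a b hab => Subtype.ext (congrArg (fun z : {c : K // c ^ q = c} => (z : K)) hab)
  have hmul : Nat.card T.ker * Nat.card T.range = q ^ 2 := by
    rw [← H.card_eq, ← T.ker.card_mul_index, AddSubgroup.index_ker]
  have hfix := H.card_fixed_le
  -- Kernel and range of the trace have at most `q` elements each and the product of their orders is
  -- `q ^ 2`, so both bounds are attained and the range is the whole set of fixed elements.
  have hk : Nat.card T.ker = q := by nlinarith
  have hr : Nat.card T.range = Nat.card {c : K // c ^ q = c} := by nlinarith
  have hbij := (Nat.bijective_iff_injective_and_card
    (fun a : T.range => (⟨a, hran a a.2⟩ : {c : K // c ^ q = c}))).2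
      ⟨fun a b hab => Subtype.ext (congrArg (fun z : {c : K // c ^ q = c} => (z : K)) hab), hr⟩
  obtain ⟨⟨_, b, rfl⟩, hb⟩ := hbij.2 ⟨c, by rw [← H.form.conj, hc]⟩
  have hbc : b + σ b = c := congrArg Subtype.val hb
  rw [← hk]
  refine Nat.card_congr ((Equiv.subRight b).subtypeEquiv fun a => ?_)
  rw [AddMonoidHom.mem_ker, hT, ← hbc, Equiv.subRight_apply, map_sub, ← sub_eq_zero]
  constructor <;> intro h0 <;> rw [← h0] <;> ring

/-- Every element fixed by the involution is a norm. -/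
theorem exists_norm_eq (H : HermitianSpace q d h) {c : K} (hc : σ c = c) :
    ∃ a : K, a * σ a = c := by
  classical
  rcases eq_or_ne c 0 with rfl | hc0
  · exact ⟨0, by simp⟩
  have := Fintype.ofFinite K
  have hq := H.one_lt
  let N : Kˣ →* Kˣ := powMonoidHom (q + 1)
  have hker : Nat.card N.ker ≤ q + 1 := by
    have h1 : ∀ a : N.ker, ((a : Kˣ) : K) ∈ (Polynomial.nthRoots (q + 1) (1 : K)).toFinset := by
      rintro ⟨a, ha⟩
      rw [Multiset.mem_toFinset, Polynomial.mem_nthRoots (by omega)]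
      have := congrArg Units.val (MonoidHom.mem_ker.1 ha)
      simpa [N] using this
    have h2 : Nat.card N.ker ≤ Nat.card ((Polynomial.nthRoots (q + 1) (1 : K)).toFinset) :=
      Nat.card_le_card_of_injective (fun a => ⟨_, h1 a⟩) fun a b hab =>
        Subtype.ext (Units.ext (congrArg Subtype.val hab))
    refine h2.trans ?_
    rw [Nat.card_eq_fintype_card, Fintype.card_coe]
    exact (Multiset.toFinset_card_le _).trans (Polynomial.card_nthRoots _ _)
  have hran : ∀ a ∈ N.range, ((a : Kˣ) : K) ∈ (Polynomial.nthRoots (q - 1) (1 : K)).toFinset := by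
    rintro _ ⟨a, rfl⟩
    rw [Multiset.mem_toFinset, Polynomial.mem_nthRoots (by omega)]
    have h1 : (a : K) ^ (Fintype.card K - 1) = 1 := FiniteField.pow_card_sub_one_eq_one _ a.ne_zero
    rw [← Nat.card_eq_fintype_card, H.card_eq] at h1
    have : (q + 1) * (q - 1) = q ^ 2 - 1 := by
      rw [← Nat.sq_sub_sq, one_pow]
    simp only [N, powMonoidHom_apply, Units.val_pow_eq_pow_val]
    rw [← pow_mul, this, h1]
  let F : N.range → (Polynomial.nthRoots (q - 1) (1 : K)).toFinset := fun a => ⟨_, hran a a.2⟩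
  have hF : Function.Injective F := fun a b hab =>
    Subtype.ext (Units.ext (congrArg Subtype.val hab))
  have hle : Nat.card (Polynomial.nthRoots (q - 1) (1 : K)).toFinset ≤ q - 1 := by
    rw [Nat.card_eq_fintype_card, Fintype.card_coe]
    exact (Multiset.toFinset_card_le _).trans (Polynomial.card_nthRoots _ _)
  have hrle := Nat.card_le_card_of_injective F hF
  have hmul : Nat.card N.ker * Nat.card N.range = (q + 1) * (q - 1) := by
    rw [← Subgroup.index_ker, N.ker.card_mul_index, Nat.card_eq_fintype_card,
      Fintype.card_units, ← Nat.card_eq_fintype_card, H.card_eq, ← Nat.sq_sub_sq, one_pow]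
  have hq1 : 0 < q - 1 := by omega
  -- Same squeeze as for the trace: the kernel has order at most `q + 1`, the range lies among the
  -- at most `q - 1` roots of `X ^ (q - 1) - 1`, and the orders multiply to `(q + 1) * (q - 1)`.
  -- Nonzero fixed elements are such roots.
  have hr : Nat.card N.range = Nat.card (Polynomial.nthRoots (q - 1) (1 : K)).toFinset := by
    nlinarith
  have hbij := (Nat.bijective_iff_injective_and_card F).2 ⟨hF, hr⟩
  have hcm : c ∈ (Polynomial.nthRoots (q - 1) (1 : K)).toFinset := by
    rw [Multiset.mem_toFinset, Polynomial.mem_nthRoots (by omega)]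
    rw [H.form.conj] at hc
    apply mul_right_cancel₀ hc0
    rw [← pow_succ, one_mul, Nat.sub_add_cancel (by omega), hc]
  obtain ⟨⟨_, a, rfl⟩, ha⟩ := hbij.2 ⟨c, hcm⟩
  have hac := congrArg Subtype.val ha
  refine ⟨a, ?_⟩
  rw [H.form.conj, ← pow_succ']
  simpa [F, N] using hac

variable [Finite V]

/-- Nondegeneracy makes `v ↦ h v` an injection of `V` into its dual, hence a bijection by
finiteness, and it carries `perp h W` onto the annihilator of `W`. This map is only semilinear, so
dimensions are compared through cardinalities. -/
theorem finrank_perp (H : HermitianSpace q d h) (W : Submodule K V) :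
    finrank K (perp h W) + finrank K W = 2 * d := by
  have hinj : Function.Injective (fun v : V => (h v : Dual K V)) := by
    intro v w hvw
    have : ∀ y, h (v - w) y = 0 := fun y => by
      simpa [sub_eq_zero] using LinearMap.congr_fun hvw y
    exact sub_eq_zero.1 (H.form.nondegenerate.1 _ this)
  have hfin : Finite (Dual K V) := Module.finite_of_finite K
  have hcard : Nat.card V = Nat.card (Dual K V) := by
    rw [natCard_eq_pow_finrank (K := K) (V := V), natCard_eq_pow_finrank (K := K) (V := Dual K V),
      Subspace.dual_finrank_eq]
  have hbij := (Nat.bijective_iff_injective_and_card _).2 ⟨hinj, hcard⟩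
  have hc : Nat.card (perp h W) = Nat.card W.dualAnnihilator :=
    Nat.card_congr ((Equiv.ofBijective _ hbij).subtypeEquiv fun v => by
      change v ∈ perp h W ↔ (h v : Dual K V) ∈ W.dualAnnihilator
      rw [mem_perp, Submodule.mem_dualAnnihilator]
      exact forall₂_congr fun w _ => H.ortho_comm)
  rw [natCard_eq_pow_finrank (K := K),
    natCard_eq_pow_finrank (K := K) (V := W.dualAnnihilator)] at hc
  have := Nat.pow_right_injective (Finite.one_lt_card (α := K)) hc
  have h2 := Subspace.finrank_add_finrank_dualAnnihilator_eq W
  have h3 := H.finrank_eq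
  omega

theorem perp_perp (H : HermitianSpace q d h) (W : Submodule K V) : perp h (perp h W) = W := by
  symm
  apply Submodule.eq_of_le_of_finrank_eq (H.le_perp_comm.1 le_rfl)
  have h1 := H.finrank_perp W
  have h2 := H.finrank_perp (perp h W)
  omega

end HermitianSpace

end Form

/-! ### Dimension of generators and projection onto residues -/

section Geometry

variable {K V : Type*} [Field K] [AddCommGroup V] [Module K V] {σ : K →+* K}

/-- The generators of the polar space of `h`. -/
abbrev Gen (h : V →ₛₗ[σ] V →ₗ[K] K) : Type _ := {x : Submodule K V // IsGenerator h x}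

theorem finrank_sup_span_singleton [Finite V] {W : Submodule K V} {v : V} (hv : v ∉ W) :
    finrank K ↥(W ⊔ K ∙ v) = finrank K W + 1 := by
  have hv0 : v ≠ 0 := fun h0 => hv (h0 ▸ W.zero_mem)
  have h1 := Submodule.finrank_sup_add_finrank_inf_eq W (K ∙ v)
  have h2 : W ⊓ K ∙ v = ⊥ := by
    rw [← disjoint_iff, Submodule.disjoint_span_singleton' hv0]
    exact hv
  rw [h2, finrank_bot, finrank_span_singleton hv0] at h1
  omega

theorem exists_le_le_finrank_eq_add_one [Finite V] {A B : Submodule K V} (hAB : A < B) :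
    ∃ C, A ≤ C ∧ C ≤ B ∧ finrank K C = finrank K A + 1 := by
  obtain ⟨v, hvB, hvA⟩ := SetLike.exists_of_lt hAB
  exact ⟨A ⊔ K ∙ v, le_sup_left, sup_le hAB.le (by simpa using hvB),
    finrank_sup_span_singleton hvA⟩

namespace HermitianSpace

variable {q d : ℕ} {h : V →ₛₗ[σ] V →ₗ[K] K} [Finite K] [Finite V]

theorem mem_perp_span_singleton (H : HermitianSpace q d h) {v w : V} :
    w ∈ perp h (K ∙ v) ↔ h w v = 0 := by
  rw [mem_perp]
  constructor
  · exact fun hw => H.ortho_comm.1 (hw v (Submodule.mem_span_singleton_self v))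
  · intro hw u hu
    obtain ⟨a, rfl⟩ := Submodule.mem_span_singleton.1 hu
    simp [H.ortho_comm.1 hw]

theorem isTotallyIsotropic_sup_span (H : HermitianSpace q d h) {W : Submodule K V}
    (hW : IsTotallyIsotropic h W) {v : V} (hv : v ∈ perp h W) (hvv : h v v = 0) :
    IsTotallyIsotropic h (W ⊔ K ∙ v) := by
  apply H.isTotallyIsotropic_sup hW
  · rw [isTotallyIsotropic_iff_le_perp, Submodule.span_singleton_le_iff_mem,
      H.mem_perp_span_singleton]
    exact hvv
  · rw [H.le_perp_comm, Submodule.span_singleton_le_iff_mem]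
    exact hv

theorem finrank_le (H : HermitianSpace q d h) {W : Submodule K V}
    (hW : IsTotallyIsotropic h W) : finrank K W ≤ d := by
  have h1 := H.finrank_perp W
  have h2 := Submodule.finrank_mono (isTotallyIsotropic_iff_le_perp.1 hW)
  omega

/-- A totally isotropic subspace of dimension less than `d` can be enlarged. -/
theorem exists_isotropic_vector (H : HermitianSpace q d h) {W : Submodule K V}
    (hW : IsTotallyIsotropic h W) (hWd : finrank K W < d) :
    ∃ v ∈ perp h W, v ∉ W ∧ h v v = 0 := by
  have hle := isTotallyIsotropic_iff_le_perp.1 hW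
  have hrk := H.finrank_perp W
  have hlt : W < perp h W := lt_of_le_of_ne hle fun h0 => by rw [← h0] at hrk; omega
  obtain ⟨u, huW, hu⟩ := SetLike.exists_of_lt hlt
  by_cases huu : h u u = 0
  · exact ⟨u, huW, hu, huu⟩
  -- Since `finrank K W < d`, `perp h W` exceeds `W` by at least two dimensions. This leaves room
  -- for a second vector, which is made orthogonal to the anisotropic `u`; a multiple of `u` with
  -- prescribed norm then cancels its length.
  have hrku := finrank_sup_span_singleton hu
  have hlt' : W ⊔ K ∙ u < perp h W := by
    refine lt_of_le_of_ne (sup_le hle (by simpa using huW)) fun h0 => ?_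
    rw [h0] at hrku
    omega
  obtain ⟨v, hvW, hv⟩ := SetLike.exists_of_lt hlt'
  set w := v - (h u v / h u u) • u with hw
  have huw : h u w = 0 := by
    simp [hw, huu]
  have hwu : h w u = 0 := H.ortho_comm.1 huw
  have hwW : w ∈ perp h W := sub_mem hvW (Submodule.smul_mem _ _ huW)
  have hwn : w ∉ W ⊔ K ∙ u := fun h0 => hv <| by
    have h1 : v = w + (h u v / h u u) • u := by rw [hw]; abel
    rw [h1]
    exact add_mem h0 (Submodule.smul_mem _ _
      (Submodule.mem_sup_right (Submodule.mem_span_singleton_self u)))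
  obtain ⟨a, ha⟩ := H.exists_norm_eq (c := -(h w w / h u u)) (by
    rw [map_neg, map_div₀, H.symm, H.symm])
  refine ⟨w + a • u, add_mem hwW (Submodule.smul_mem _ _ huW), fun h0 => hwn ?_, ?_⟩
  · have h1 : w = (w + a • u) - a • u := by abel
    rw [h1]
    exact sub_mem (Submodule.mem_sup_left h0) (Submodule.smul_mem _ _
      (Submodule.mem_sup_right (Submodule.mem_span_singleton_self u)))
  · have h1 : h (w + a • u) (w + a • u) = h w w + (a * σ a) * h u u := by
      simp [huw, hwu]
      ring
    rw [h1, ha]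
    field_simp
    ring

theorem finrank_gen (H : HermitianSpace q d h) {x : Submodule K V} (hx : IsGenerator h x) :
    finrank K x = d := by
  by_contra hne
  obtain ⟨v, hv, hvx, hvv⟩ := H.exists_isotropic_vector hx.prop
    (lt_of_le_of_ne (H.finrank_le hx.prop) hne)
  exact hvx (hx.le_of_ge (H.isTotallyIsotropic_sup_span hx.prop hv hvv) le_sup_left
    (Submodule.mem_sup_right (Submodule.mem_span_singleton_self v)))

theorem isGenerator_of_finrank (H : HermitianSpace q d h) {x : Submodule K V}
    (hx : IsTotallyIsotropic h x) (hxd : finrank K x = d) : IsGenerator h x :=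
  ⟨hx, fun y hy hxy => (Submodule.eq_of_le_of_finrank_le hxy
    (by rw [hxd]; exact H.finrank_le hy)).ge⟩

theorem exists_gen_ge (h : V →ₛₗ[σ] V →ₗ[K] K) {W : Submodule K V}
    (hW : IsTotallyIsotropic h W) : ∃ x : Gen h, W ≤ x := by
  obtain ⟨x, hx, hmax⟩ := Finite.exists_le_maximal hW
  exact ⟨⟨x, hmax⟩, hx⟩

theorem finrank_coe (H : HermitianSpace q d h) (x : Gen h) : finrank K x.1 = d :=
  H.finrank_gen x.2

theorem isTotallyIsotropic_of_le {W : Submodule K V} {x : Gen h} (hW : W ≤ x) :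
    IsTotallyIsotropic h W := fun a ha b hb => x.2.prop a (hW ha) b (hW hb)

theorem perp_coe (H : HermitianSpace q d h) (x : Gen h) : perp h x.1 = x := by
  symm
  apply Submodule.eq_of_le_of_finrank_eq (isTotallyIsotropic_iff_le_perp.1 x.2.prop)
  have h1 := H.finrank_perp x.1
  have h2 := H.finrank_coe x
  omega

theorem le_perp_of_le (H : HermitianSpace q d h) {W : Submodule K V} {x : Gen h}
    (hW : W ≤ x) : x.1 ≤ perp h W := by
  rw [H.le_perp_comm, H.perp_coe]
  exact hW

theorem gen_eq_of_le (H : HermitianSpace q d h) {x y : Gen h} (hxy : x.1 ≤ y) : x = y :=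
  Subtype.ext (Submodule.eq_of_le_of_finrank_eq hxy (by rw [H.finrank_coe, H.finrank_coe]))

/-- As `y` is its own perp, `perp h W ⊓ y` is the perp of `W ⊔ y`. -/
theorem finrank_perp_inf (H : HermitianSpace q d h) (W : Submodule K V) (y : Gen h) :
    finrank K ↥(perp h W ⊓ y.1) + finrank K W = d + finrank K ↥(W ⊓ y.1) := by
  have h1 := H.finrank_perp (W ⊔ y.1)
  rw [perp_sup, H.perp_coe] at h1
  have h2 := Submodule.finrank_sup_add_finrank_inf_eq W y.1
  have h3 := H.finrank_coe y
  omega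

/-- The projection of the generator `y` onto the residue of `W`. -/
theorem isTotallyIsotropic_proj (H : HermitianSpace q d h) {W : Submodule K V}
    (hW : IsTotallyIsotropic h W) (y : Gen h) :
    IsTotallyIsotropic h (W ⊔ (perp h W ⊓ y.1)) :=
  H.isTotallyIsotropic_sup hW (isTotallyIsotropic_of_le inf_le_right)
    (H.le_perp_comm.1 inf_le_left)

theorem finrank_proj (H : HermitianSpace q d h) {W : Submodule K V}
    (hW : IsTotallyIsotropic h W) (y : Gen h) :
    finrank K ↥(W ⊔ (perp h W ⊓ y.1)) = d := by
  have h1 := H.finrank_perp_inf W y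
  have h2 := Submodule.finrank_sup_add_finrank_inf_eq W (perp h W ⊓ y.1)
  rw [← inf_assoc, inf_eq_left.2 (isTotallyIsotropic_iff_le_perp.1 hW)] at h2
  omega

/-- The generator through `W` that is the projection of `y` onto the residue of `W`. -/
def proj (H : HermitianSpace q d h) {W : Submodule K V}
    (hW : IsTotallyIsotropic h W) (y : Gen h) : Gen h :=
  ⟨W ⊔ (perp h W ⊓ y.1),
    H.isGenerator_of_finrank (H.isTotallyIsotropic_proj hW y) (H.finrank_proj hW y)⟩

theorem le_proj (H : HermitianSpace q d h) {W : Submodule K V}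
    (hW : IsTotallyIsotropic h W) (y : Gen h) : W ≤ (H.proj hW y).1 := le_sup_left

theorem perp_inf_le_proj (H : HermitianSpace q d h) {W : Submodule K V}
    (hW : IsTotallyIsotropic h W) (y : Gen h) : perp h W ⊓ y.1 ≤ (H.proj hW y).1 :=
  le_sup_right

/-- Among the generators through a totally isotropic subspace `W` of dimension `d - 1`, exactly
one meets a given generator `y` in more than `W ⊓ y`. -/
theorem finrank_proj_inf (H : HermitianSpace q d h) {W : Submodule K V}
    (hW : IsTotallyIsotropic h W) (hWd : finrank K W + 1 = d) (y : Gen h) :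
    finrank K ↥((H.proj hW y).1 ⊓ y.1) = finrank K ↥(W ⊓ y.1) + 1 := by
  have h1 := H.finrank_perp_inf W y
  have h2 : (H.proj hW y).1 ⊓ y.1 = perp h W ⊓ y.1 :=
    le_antisymm (inf_le_inf_right _ (H.le_perp_of_le (H.le_proj hW y)))
      (le_inf (H.perp_inf_le_proj hW y) inf_le_right)
  rw [h2]
  omega

/-- `z ⊓ y` lies between `W ⊓ y` and `perp h W ⊓ y`, whose dimensions differ by one. Equality with
the larger one would force `z` to contain the projection of `y`. -/
theorem inf_eq_of_ne_proj (H : HermitianSpace q d h) {W : Submodule K V}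
    (hW : IsTotallyIsotropic h W) (hWd : finrank K W + 1 = d) (y : Gen h) {z : Gen h}
    (hz : W ≤ z.1) (hne : z ≠ H.proj hW y) : z.1 ⊓ y.1 = W ⊓ y.1 := by
  have h1 := H.finrank_perp_inf W y
  have hle : z.1 ⊓ y.1 ≤ perp h W ⊓ y.1 := inf_le_inf_right _ (H.le_perp_of_le hz)
  have hle2 : W ⊓ y.1 ≤ z.1 ⊓ y.1 := inf_le_inf_right _ hz
  symm
  apply Submodule.eq_of_le_of_finrank_le hle2
  by_contra hlt
  have h3 : z.1 ⊓ y.1 = perp h W ⊓ y.1 :=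
    Submodule.eq_of_le_of_finrank_le hle (by omega)
  have h4 : (H.proj hW y).1 ≤ z.1 := sup_le hz (h3 ▸ inf_le_left)
  exact hne (H.gen_eq_of_le h4).symm

end HermitianSpace

end Geometry

open scoped Classical

/-! ### Counting hyperplanes, and generators through a subspace of dimension `d - 1` -/

section Counting

/-- The number of points of a projective space of dimension `k - 1` over the field of order
`q ^ 2`. -/
noncomputable def gaussNum (q k : ℕ) : ℝ := ((q : ℝ) ^ (2 * k) - 1) / ((q : ℝ) ^ 2 - 1)

theorem gaussNum_succ {q : ℕ} (hq : 1 < q) (k : ℕ) :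
    gaussNum q (k + 1) = gaussNum q k + (q : ℝ) ^ (2 * k) := by
  have h1 : (1 : ℝ) < q := by exact_mod_cast hq
  have h2 : (q : ℝ) ^ 2 - 1 ≠ 0 := by nlinarith
  unfold gaussNum
  field_simp
  ring

variable {K V : Type*} [Field K] [AddCommGroup V] [Module K V] {σ : K →+* K}

noncomputable instance [Finite V] : Fintype (Submodule K V) := Fintype.ofFinite _

noncomputable instance [Finite V] (h : V →ₛₗ[σ] V →ₗ[K] K) : Fintype (Gen h) :=
  Fintype.ofFinite _

namespace HermitianSpace

variable {q d : ℕ} {h : V →ₛₗ[σ] V →ₗ[K] K} [Finite K] [Finite V]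

theorem one_lt_real (H : HermitianSpace q d h) : (1 : ℝ) < q := by exact_mod_cast H.one_lt

theorem card_mem (H : HermitianSpace q d h) [Fintype V] (A : Submodule K V) :
    Finset.card {v : V | v ∈ A} = q ^ (2 * finrank K A) := by
  have h1 : Nat.card A = q ^ (2 * finrank K A) := by
    rw [natCard_eq_pow_finrank (K := K), H.card_eq, ← pow_mul]
  rw [← h1, Nat.card_eq_fintype_card, Fintype.card_subtype]

theorem card_mem_not_mem (H : HermitianSpace q d h) [Fintype V] {A B : Submodule K V}
    (hAB : A ≤ B) : (Finset.card {v : V | v ∈ B ∧ v ∉ A} : ℝ) =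
      (q : ℝ) ^ (2 * finrank K B) - (q : ℝ) ^ (2 * finrank K A) := by
  have h1 := Finset.card_filter_add_card_filter_not (s := {v : V | v ∈ B}) (fun v => v ∈ A)
  rw [Finset.filter_filter, Finset.filter_filter, H.card_mem] at h1
  have h2 : ({v : V | v ∈ B ∧ v ∈ A} : Finset V) = ({v : V | v ∈ A} : Finset V) := by
    ext v
    simpa using fun hv => hAB hv
  rw [h2, H.card_mem] at h1
  have h3 : ((q ^ (2 * finrank K B) : ℕ) : ℝ) = _ := congrArg Nat.cast h1.symm
  push_cast at h3
  linarith

theorem finrank_inf_perp_span (H : HermitianSpace q d h) {W : Submodule K V} {v : V}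
    (hv : v ∉ perp h W) : finrank K ↥(W ⊓ perp h (K ∙ v)) + 1 = finrank K W := by
  have hv0 : v ≠ 0 := fun h0 => hv (h0 ▸ (perp h W).zero_mem)
  have hlt : W ⊓ perp h (K ∙ v) < W := by
    refine lt_of_le_of_ne inf_le_left fun h0 => hv fun w hw => ?_
    rw [← h0] at hw
    exact H.mem_perp_span_singleton.1 hw.2
  have h1 := Submodule.finrank_lt_finrank_of_lt hlt
  have h2 := H.finrank_perp (K ∙ v)
  rw [finrank_span_singleton hv0] at h2
  have h3 := Submodule.finrank_sup_add_finrank_inf_eq W (perp h (K ∙ v))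
  have h4 := Submodule.finrank_le (W ⊔ perp h (K ∙ v))
  rw [H.finrank_eq] at h4
  omega

/-- The number of hyperplanes of `W` containing `T`. -/
theorem card_hyperplanes (H : HermitianSpace q d h) {T W : Submodule K V} (hTW : T ≤ W) :
    (Finset.card {A : Submodule K V | T ≤ A ∧ A ≤ W ∧ finrank K A + 1 = finrank K W} : ℝ) =
      gaussNum q (finrank K W - finrank K T) := by
  have := Fintype.ofFinite V
  have hq := H.one_lt_real
  set t : Finset (Submodule K V) := {A | T ≤ A ∧ A ≤ W ∧ finrank K A + 1 = finrank K W} with ht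
  -- Double counting: `v ↦ W ⊓ v^⊥` sends these vectors to the hyperplanes of `W` containing `T`,
  -- and the fibre over `A` is `perp h A` minus `perp h W`.
  set s : Finset V := {v | v ∈ perp h T ∧ v ∉ perp h W} with hs
  have hmaps : Set.MapsTo (fun v => W ⊓ perp h (K ∙ v)) (s : Set V) t := by
    intro v hv
    simp only [hs, Finset.coe_filter, Finset.mem_univ, true_and, Set.mem_ofPred_eq] at hv
    simp only [ht, Finset.coe_filter, Finset.mem_univ, true_and, Set.mem_ofPred_eq]
    exact ⟨le_inf hTW fun w hw => H.mem_perp_span_singleton.2 (hv.1 w hw), inf_le_left,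
      H.finrank_inf_perp_span hv.2⟩
  have hcount := Finset.card_eq_sum_card_fiberwise hmaps
  have hfib : ∀ A ∈ t, (({v ∈ s | W ⊓ perp h (K ∙ v) = A} : Finset V).card : ℝ) =
      (q : ℝ) ^ (2 * (2 * d - finrank K W)) * ((q : ℝ) ^ 2 - 1) := by
    intro A hA
    simp only [ht, Finset.mem_filter, Finset.mem_univ, true_and] at hA
    obtain ⟨hTA, hAW, hrk⟩ := hA
    have : ({v ∈ s | W ⊓ perp h (K ∙ v) = A} : Finset V) =
        ({v | v ∈ perp h A ∧ v ∉ perp h W} : Finset V) := by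
      ext v
      simp only [hs, Finset.mem_filter, Finset.mem_univ, true_and]
      constructor
      · rintro ⟨⟨-, hvW⟩, rfl⟩
        exact ⟨fun w hw => H.mem_perp_span_singleton.1 hw.2, hvW⟩
      · rintro ⟨hvA, hvW⟩
        refine ⟨⟨perp_anti hTA hvA, hvW⟩, (Submodule.eq_of_le_of_finrank_eq
          (le_inf hAW fun w hw => H.mem_perp_span_singleton.2 (hvA w hw)) ?_).symm⟩
        have := H.finrank_inf_perp_span hvW
        omega
    rw [this, H.card_mem_not_mem (perp_anti hAW)]
    have h1 := H.finrank_perp A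
    have h2 := H.finrank_perp W
    rw [show finrank K (perp h A) = (2 * d - finrank K W) + 1 by omega,
      show finrank K (perp h W) = 2 * d - finrank K W by omega]
    ring
  have hcount' : (s.card : ℝ) = ∑ A ∈ t, (({v ∈ s | W ⊓ perp h (K ∙ v) = A} : Finset V).card : ℝ) := by
    exact_mod_cast hcount
  rw [Finset.sum_congr rfl hfib, Finset.sum_const, nsmul_eq_mul, hs,
    H.card_mem_not_mem (perp_anti hTW)] at hcount'
  have h1 := H.finrank_perp T
  have h2 := H.finrank_perp W
  have h3 := Submodule.finrank_mono hTW
  obtain ⟨e, he⟩ := Nat.exists_eq_add_of_le h3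
  rw [show finrank K (perp h T) = (2 * d - finrank K W) + e by omega,
      show finrank K (perp h W) = 2 * d - finrank K W by omega, mul_add, pow_add] at hcount'
  rw [show finrank K W - finrank K T = e by omega]
  unfold gaussNum
  have hp : (q : ℝ) ^ (2 * (2 * d - finrank K W)) ≠ 0 := by positivity
  have hQ : (q : ℝ) ^ 2 - 1 ≠ 0 := by nlinarith
  rw [eq_div_iff hQ]
  apply mul_left_cancel₀ hp
  linarith

/-- There are `q` generators other than `x` through a subspace of `x` of dimension `d - 1`. -/
theorem card_gen_ge (H : HermitianSpace q d h) {W : Submodule K V}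
    (hW : IsTotallyIsotropic h W) (hWd : finrank K W + 1 = d) (x : Gen h) (hWx : W ≤ x) :
    Finset.card {z : Gen h | W ≤ z.1 ∧ z ≠ x} = q := by
  have hrkx := H.finrank_coe x
  have hlt : W < x.1 := lt_of_le_of_ne hWx fun h0 => by rw [h0] at hWd; omega
  obtain ⟨u, hux, huW⟩ := SetLike.exists_of_lt hlt
  have hx : W ⊔ K ∙ u = x.1 := Submodule.eq_of_le_of_finrank_eq
    (sup_le hWx (by simpa using hux)) (by rw [finrank_sup_span_singleton huW]; omega)
  have hrkW := H.finrank_perp W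
  have hxW := H.le_perp_of_le hWx
  have hlt2 : x.1 < perp h W := lt_of_le_of_ne hxW fun h0 => by rw [h0] at hrkx; omega
  obtain ⟨v, hvW, hvx⟩ := SetLike.exists_of_lt hlt2
  have hxv : x.1 ⊔ K ∙ v = perp h W := Submodule.eq_of_le_of_finrank_eq
    (sup_le hxW (by simpa using hvW)) (by rw [finrank_sup_span_singleton hvx]; omega)
  have huu : h u u = 0 := x.2.prop u hux u hux
  have hvu : h v u ≠ 0 := by
    intro h0
    apply hvx
    rw [← H.perp_coe x, ← hx, perp_sup]
    refine ⟨hvW, ?_⟩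
    rw [SetLike.mem_coe, H.mem_perp_span_singleton]
    exact h0
  have huv : h u v ≠ 0 := fun h0 => hvu (H.ortho_comm.1 h0)
  have hnotW : ∀ t : K, v + t • u ∉ x.1 := fun t h0 => hvx <| by
    have := sub_mem h0 (x.1.smul_mem t hux)
    simpa using this
  -- `perp h W` is spanned by `W`, `u` and `v`, so the generators through `W` other than `x` are the
  -- `W ⊔ K ∙ (v + t • u)` with `v + t • u` isotropic. In terms of `a = t * h v u` this says that
  -- `a` has trace `-h v v`, which has `q` solutions.
  have hform : ∀ t : K, h (v + t • u) (v + t • u) = h v v + (t * h v u + σ (t * h v u)) := by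
    intro t
    simp [huu, H.symm]
    ring
  have hmem : ∀ t : K, v + t • u ∈ perp h W := fun t =>
    add_mem hvW (Submodule.smul_mem _ _ (hxW hux))
  have hgen : ∀ a : {a : K // a + σ a = -h v v},
      IsGenerator h (W ⊔ K ∙ (v + (a.1 / h v u) • u)) := fun a =>
    H.isGenerator_of_finrank (H.isTotallyIsotropic_sup_span hW (hmem _) (by
      rw [hform, div_mul_cancel₀ _ hvu, a.2]; ring))
      (by rw [finrank_sup_span_singleton fun h0 => hnotW _ (hWx h0)]; exact hWd)
  let F : {a : K // a + σ a = -h v v} → {z : Gen h // W ≤ z.1 ∧ z ≠ x} := fun a =>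
    ⟨⟨_, hgen a⟩, le_sup_left, fun h0 => hnotW (a.1 / h v u) <| by
      rw [← h0]
      exact Submodule.mem_sup_right (Submodule.mem_span_singleton_self _)⟩
  have hFmem : ∀ a, v + (a.1 / h v u) • u ∈ (F a).1.1 := fun a =>
    Submodule.mem_sup_right (Submodule.mem_span_singleton_self _)
  have hF : Function.Bijective F := by
    constructor
    · intro a b hab
      by_contra hne
      have h1 := hFmem a
      have h2 := hFmem b
      rw [← hab] at h2
      have h3 := sub_mem h1 h2
      have hab' : a.1 / h v u - b.1 / h v u ≠ 0 := by
        rw [← sub_div]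
        exact div_ne_zero (sub_ne_zero.2 fun h0 => hne (Subtype.ext h0)) hvu
      rw [add_sub_add_left_eq_sub, ← sub_smul, Submodule.smul_mem_iff _ hab'] at h3
      have h4 : x.1 ≤ (F a).1.1 := by
        rw [← hx]
        exact sup_le (F a).2.1 (by simpa using h3)
      exact (F a).2.2 (H.gen_eq_of_le h4).symm
    · rintro ⟨z, hWz, hzx⟩
      have hlt3 : W < z.1 := lt_of_le_of_ne hWz fun h0 => by
        have := H.finrank_coe z
        rw [← h0] at this
        omega
      obtain ⟨w, hwz, hwW⟩ := SetLike.exists_of_lt hlt3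
      have hwp : w ∈ perp h W := H.le_perp_of_le hWz hwz
      rw [← hxv, ← hx, Submodule.mem_sup] at hwp
      obtain ⟨y, hy, v', hv', rfl⟩ := hwp
      obtain ⟨c, hc, u', hu', rfl⟩ := Submodule.mem_sup.1 hy
      obtain ⟨s, rfl⟩ := Submodule.mem_span_singleton.1 hv'
      obtain ⟨b, rfl⟩ := Submodule.mem_span_singleton.1 hu'
      have h1 : b • u + s • v ∈ z.1 := by
        have := sub_mem hwz (hWz hc)
        rwa [add_assoc, add_sub_cancel_left] at this
      have hs : s ≠ 0 := by
        rintro rfl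
        have hb : b ≠ 0 := by
          rintro rfl
          apply hwW
          simpa using hc
        rw [zero_smul, add_zero, Submodule.smul_mem_iff _ hb] at h1
        have h4 : x.1 ≤ z.1 := by
          rw [← hx]
          exact sup_le hWz (by simpa using h1)
        exact hzx (H.gen_eq_of_le h4).symm
      have h2 : v + (b / s) • u ∈ z.1 := by
        have := z.1.smul_mem s⁻¹ h1
        rw [smul_add, smul_smul, smul_smul, inv_mul_cancel₀ hs, one_smul, add_comm] at this
        rwa [div_eq_inv_mul]
      have h3 := z.2.prop _ h2 _ h2
      rw [hform] at h3
      refine ⟨⟨b / s * h v u, by linear_combination h3⟩, Subtype.ext ?_⟩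
      apply H.gen_eq_of_le
      change W ⊔ K ∙ (v + (b / s * h v u / h v u) • u) ≤ z.1
      rw [mul_div_cancel_right₀ _ hvu]
      exact sup_le hWz (by simpa using h2)
  have hcard := Nat.card_congr (Equiv.ofBijective F hF)
  rw [H.card_trace_eq (by rw [map_neg, H.symm]), Nat.card_eq_fintype_card,
    Fintype.card_subtype] at hcard
  exact hcard.symm

/-- Distribution of the intersection dimensions with a generator `y` over the generators through
a totally isotropic subspace of dimension `d - 1`. -/
theorem card_gen_ge_finrank_inf (H : HermitianSpace q d h) {W : Submodule K V}
    (hW : IsTotallyIsotropic h W) (hWd : finrank K W + 1 = d) (y : Gen h) (c : ℕ) :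
    (Finset.card {z : Gen h | W ≤ z.1 ∧ finrank K ↥(z.1 ⊓ y.1) = c} : ℝ) =
      (if finrank K ↥(W ⊓ y.1) + 1 = c then 1 else 0) +
        (if finrank K ↥(W ⊓ y.1) = c then (q : ℝ) else 0) := by
  have hpr := H.finrank_proj_inf hW hWd y
  have hq := H.card_gen_ge hW hWd _ (H.le_proj hW y)
  have h1 : ∀ z ∈ ({z : Gen h | W ≤ z.1 ∧ z ≠ H.proj hW y} : Finset (Gen h)),
      finrank K ↥(z.1 ⊓ y.1) = finrank K ↥(W ⊓ y.1) := by
    intro z hz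
    simp only [Finset.mem_filter, Finset.mem_univ, true_and] at hz
    rw [H.inf_eq_of_ne_proj hW hWd y hz.1 hz.2]
  have h2 : ({z : Gen h | W ≤ z.1} : Finset (Gen h)) =
      insert (H.proj hW y) ({z : Gen h | W ≤ z.1 ∧ z ≠ H.proj hW y} : Finset (Gen h)) := by
    ext z
    simp only [Finset.mem_filter, Finset.mem_univ, true_and, Finset.mem_insert]
    constructor
    · intro hz
      by_cases h0 : z = H.proj hW y
      · exact Or.inl h0
      · exact Or.inr ⟨hz, h0⟩
    · rintro (rfl | hz)
      · exact H.le_proj hW y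
      · exact hz.1
  rw [← Finset.filter_filter, Finset.natCast_card_filter, h2, Finset.sum_insert (by simp), hpr]
  congr 1
  rw [Finset.sum_congr rfl fun z hz => by rw [h1 z hz], Finset.sum_const, hq]
  simp

end HermitianSpace

end Counting

/-! ### Counting generators by projecting to a residue -/

section CountingGenerators

variable {K V : Type*} [Field K] [AddCommGroup V] [Module K V] {σ : K →+* K}

namespace HermitianSpace

variable {q d : ℕ} {h : V →ₛₗ[σ] V →ₗ[K] K} [Finite K] [Finite V]

theorem card_hyperplanes_not_ge (H : HermitianSpace q d h) {R R' W : Submodule K V}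
    (hR : R ≤ R') (hR' : R' ≤ W) (hrk : finrank K R' = finrank K R + 1) :
    (Finset.card {A : Submodule K V | (R ≤ A ∧ A ≤ W ∧ finrank K A + 1 = finrank K W) ∧
      ¬ R' ≤ A} : ℝ) = (q : ℝ) ^ (2 * (finrank K W - finrank K R')) := by
  have h1 := Finset.card_filter_add_card_filter_not
    (s := {A : Submodule K V | R ≤ A ∧ A ≤ W ∧ finrank K A + 1 = finrank K W})
    (fun A => R' ≤ A)
  have h2 : ({A : Submodule K V | (R ≤ A ∧ A ≤ W ∧ finrank K A + 1 = finrank K W) ∧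
      R' ≤ A} : Finset (Submodule K V)) =
      ({A : Submodule K V | R' ≤ A ∧ A ≤ W ∧ finrank K A + 1 = finrank K W} :
        Finset (Submodule K V)) := by
    ext A
    simp only [Finset.mem_filter, Finset.mem_univ, true_and]
    exact ⟨fun hA => ⟨hA.2, hA.1.2⟩, fun hA => ⟨⟨hR.trans hA.1, hA.2⟩, hA.1⟩⟩
  rw [Finset.filter_filter, Finset.filter_filter, h2] at h1
  have h3 : (_ : ℝ) = _ := congrArg (Nat.cast (R := ℝ)) h1
  rw [Nat.cast_add, H.card_hyperplanes hR', H.card_hyperplanes (hR.trans hR')] at h3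
  have h4 := Submodule.finrank_mono hR'
  rw [show finrank K W - finrank K R = (finrank K W - finrank K R') + 1 by omega,
    gaussNum_succ H.one_lt] at h3
  linarith

/-- The fibres of the projection onto the residue of `R'`, restricted to the generators through
a hyperplane `R` of `R'`. -/
theorem card_proj_fiber (H : HermitianSpace q d h) {R R' : Submodule K V} (hR : R ≤ R')
    (hrk : finrank K R' = finrank K R + 1) (hR' : IsTotallyIsotropic h R') (y' : Gen h)
    (hy' : R' ≤ y'.1) :
    (Finset.card {y : Gen h | R ≤ y.1 ∧ ¬ R' ≤ y.1 ∧ H.proj hR' y = y'} : ℝ) =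
      (q : ℝ) ^ (2 * (d - finrank K R') + 1) := by
  have hrky := H.finrank_coe y'
  set s : Finset (Gen h) := {y : Gen h | R ≤ y.1 ∧ ¬ R' ≤ y.1 ∧ H.proj hR' y = y'} with hs
  set t : Finset (Submodule K V) :=
    {A : Submodule K V | (R ≤ A ∧ A ≤ y'.1 ∧ finrank K A + 1 = finrank K y'.1) ∧ ¬ R' ≤ A} with ht
  have hR'p := isTotallyIsotropic_iff_le_perp.1 hR'
  have hrkmeet : ∀ y : Gen h, R ≤ y.1 → ¬ R' ≤ y.1 →
      finrank K ↥(perp h R' ⊓ y.1) + 1 = d := by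
    intro y hRy hR'y
    have h1 := H.finrank_perp_inf R' y
    have h2 : R' ⊓ y.1 = R := by
      symm
      apply Submodule.eq_of_le_of_finrank_le (le_inf hR hRy)
      have h3 : R' ⊓ y.1 < R' := lt_of_le_of_ne inf_le_left fun h0 => hR'y (inf_eq_left.1 h0)
      have := Submodule.finrank_lt_finrank_of_lt h3
      omega
    rw [h2] at h1
    omega
  -- Each `y` in the fibre is recorded by the hyperplane `A = perp h R' ⊓ y` of `y'`, which does not
  -- contain `R'`. Conversely, every such `A` arises from exactly the `q` generators through `A`
  -- other than `y'`.
  have hmaps : Set.MapsTo (fun y : Gen h => perp h R' ⊓ y.1) (s : Set (Gen h)) t := by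
    intro y hy
    simp only [hs, Finset.coe_filter, Finset.mem_univ, true_and, Set.mem_ofPred_eq] at hy
    simp only [ht, Finset.coe_filter, Finset.mem_univ, true_and, Set.mem_ofPred_eq]
    obtain ⟨hRy, hR'y, rfl⟩ := hy
    refine ⟨⟨le_inf (hR.trans hR'p) hRy, H.perp_inf_le_proj hR' y, ?_⟩, fun h0 => hR'y ?_⟩
    · rw [hrky]
      exact hrkmeet y hRy hR'y
    · exact h0.trans inf_le_right
  have hfib : ∀ A ∈ t, (({y ∈ s | perp h R' ⊓ y.1 = A} : Finset (Gen h)).card : ℝ) = q := by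
    intro A hA
    simp only [ht, Finset.mem_filter, Finset.mem_univ, true_and] at hA
    obtain ⟨⟨hRA, hAy', hrkA⟩, hR'A⟩ := hA
    rw [hrky] at hrkA
    have hsup : R' ⊔ A = y'.1 := by
      apply Submodule.eq_of_le_of_finrank_le (sup_le hy' hAy')
      have h1 : A < R' ⊔ A := lt_of_le_of_ne le_sup_right fun h0 => hR'A (h0 ▸ le_sup_left)
      have := Submodule.finrank_lt_finrank_of_lt h1
      omega
    rw [← H.card_gen_ge (isTotallyIsotropic_of_le hAy') hrkA y' hAy']
    congr 2
    ext y
    simp only [hs, Finset.mem_filter, Finset.mem_univ, true_and]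
    constructor
    · rintro ⟨⟨-, hR'y, -⟩, rfl⟩
      exact ⟨inf_le_right, fun h0 => hR'y (h0 ▸ hy')⟩
    · rintro ⟨hAy, hne⟩
      have hR'y : ¬ R' ≤ y.1 := fun h0 => hne (H.gen_eq_of_le (by
        rw [← hsup]
        exact sup_le h0 hAy)).symm
      have hmeet : perp h R' ⊓ y.1 = A := by
        symm
        apply Submodule.eq_of_le_of_finrank_eq
          (le_inf (hAy'.trans (H.le_perp_of_le hy')) hAy)
        have := hrkmeet y (hRA.trans hAy) hR'y
        omega
      refine ⟨⟨hRA.trans hAy, hR'y, Subtype.ext ?_⟩, hmeet⟩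
      change R' ⊔ (perp h R' ⊓ y.1) = y'.1
      rw [hmeet, hsup]
  have hcount := congrArg (Nat.cast (R := ℝ)) (Finset.card_eq_sum_card_fiberwise hmaps)
  rw [Nat.cast_sum, Finset.sum_congr rfl hfib, Finset.sum_const, nsmul_eq_mul, ht,
    H.card_hyperplanes_not_ge hR hy' hrk, hrky] at hcount
  rw [hcount, pow_succ]

/-- Counting generators through `R` by projecting them onto the residue of `R'`. -/
theorem card_eq_mul_card_proj (H : HermitianSpace q d h) {R R' : Submodule K V} (hR : R ≤ R')
    (hrk : finrank K R' = finrank K R + 1) (hR' : IsTotallyIsotropic h R') {P P' : Gen h → Prop}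
    (hP : ∀ y, R ≤ y.1 → ¬ R' ≤ y.1 → (P y ↔ P' (H.proj hR' y))) :
    (Finset.card {y : Gen h | R ≤ y.1 ∧ ¬ R' ≤ y.1 ∧ P y} : ℝ) =
      (q : ℝ) ^ (2 * (d - finrank K R') + 1) *
        (Finset.card {y : Gen h | R' ≤ y.1 ∧ P' y} : ℝ) := by
  set s : Finset (Gen h) := {y : Gen h | R ≤ y.1 ∧ ¬ R' ≤ y.1 ∧ P y} with hs
  set t : Finset (Gen h) := {y : Gen h | R' ≤ y.1 ∧ P' y} with ht
  have hmaps : Set.MapsTo (fun y : Gen h => H.proj hR' y) (s : Set (Gen h)) t := by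
    intro y hy
    simp only [hs, Finset.coe_filter, Finset.mem_univ, true_and, Set.mem_ofPred_eq] at hy
    simp only [ht, Finset.coe_filter, Finset.mem_univ, true_and, Set.mem_ofPred_eq]
    exact ⟨H.le_proj hR' y, (hP y hy.1 hy.2.1).1 hy.2.2⟩
  have hfib : ∀ y' ∈ t, (({y ∈ s | H.proj hR' y = y'} : Finset (Gen h)).card : ℝ) =
      (q : ℝ) ^ (2 * (d - finrank K R') + 1) := by
    intro y' hy'
    simp only [ht, Finset.mem_filter, Finset.mem_univ, true_and] at hy'
    rw [← H.card_proj_fiber hR hrk hR' y' hy'.1, hs, Finset.filter_filter]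
    congr 2
    ext y
    simp only [Finset.mem_filter, Finset.mem_univ, true_and]
    constructor
    · rintro ⟨⟨h1, h2, -⟩, h3⟩
      exact ⟨h1, h2, h3⟩
    · rintro ⟨h1, h2, h3⟩
      exact ⟨⟨h1, h2, (hP y h1 h2).2 (h3 ▸ hy'.2)⟩, h3⟩
  have hcount := congrArg (Nat.cast (R := ℝ)) (Finset.card_eq_sum_card_fiberwise hmaps)
  rw [Nat.cast_sum, Finset.sum_congr rfl hfib, Finset.sum_const, nsmul_eq_mul] at hcount
  rw [hcount, mul_comm]

/-- The number of generators through a totally isotropic subspace. -/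
theorem card_gen_through (H : HermitianSpace q d h) (e : ℕ) {R : Submodule K V}
    (hR : IsTotallyIsotropic h R) (he : finrank K R + e = d) :
    (Finset.card {y : Gen h | R ≤ y.1} : ℝ) =
      ∏ i ∈ Finset.Icc 1 e, ((q : ℝ) ^ (2 * i - 1) + 1) := by
  induction e generalizing R with
  | zero =>
    obtain ⟨x, hx⟩ := exists_gen_ge h hR
    have hxR : R = x.1 := Submodule.eq_of_le_of_finrank_eq hx (by rw [H.finrank_coe]; exact he)
    have : ({y : Gen h | R ≤ y.1} : Finset (Gen h)) = {x} := by
      ext y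
      simp only [Finset.mem_filter, Finset.mem_univ, true_and, Finset.mem_singleton]
      constructor
      · intro hy
        rw [hxR] at hy
        exact (H.gen_eq_of_le hy).symm
      · rintro rfl
        exact hx
    rw [this]
    simp
  | succ e ih =>
    obtain ⟨x, hx⟩ := exists_gen_ge h hR
    have hlt : R < x.1 := lt_of_le_of_ne hx fun h0 => by
      have := H.finrank_coe x
      rw [← h0] at this
      omega
    obtain ⟨R', hRR', hR'x, hrk⟩ := exists_le_le_finrank_eq_add_one hlt
    have hR' := isTotallyIsotropic_of_le hR'x
    -- Generators through `R` either contain `R'` or project to one that does, with fibres of size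
    -- `q ^ (2 * e + 1)`; this gives the new factor `q ^ (2 * (e + 1) - 1) + 1`.
    have h1 := Finset.card_filter_add_card_filter_not (s := {y : Gen h | R ≤ y.1})
      (fun y => R' ≤ y.1)
    rw [Finset.filter_filter, Finset.filter_filter] at h1
    have h2 : ({y : Gen h | R ≤ y.1 ∧ R' ≤ y.1} : Finset (Gen h)) =
        ({y : Gen h | R' ≤ y.1} : Finset (Gen h)) := by
      ext y
      simpa using fun hy => hRR'.trans hy
    have h3 := H.card_eq_mul_card_proj hRR' hrk hR' (P := fun _ => True) (P' := fun _ => True)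
      fun _ _ _ => Iff.rfl
    simp only [and_true] at h3
    have h4 := congrArg (Nat.cast (R := ℝ)) h1
    rw [h2, Nat.cast_add, h3, ih hR' (by omega)] at h4
    rw [← h4, Finset.prod_Icc_succ_top (by omega),
      show 2 * (d - finrank K R') + 1 = 2 * (e + 1) - 1 by omega]
    ring

/-- The number of generators meeting the generator `x` exactly in `R`. -/
theorem card_gen_inf_eq (H : HermitianSpace q d h) (e : ℕ) {R : Submodule K V} (x : Gen h)
    (hR : R ≤ x.1) (he : finrank K R + e = d) :
    (Finset.card {y : Gen h | R ≤ y.1 ∧ y.1 ⊓ x.1 = R} : ℝ) = (q : ℝ) ^ e ^ 2 := by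
  induction e generalizing R with
  | zero =>
    have hxR : R = x.1 := Submodule.eq_of_le_of_finrank_eq hR (by rw [H.finrank_coe]; exact he)
    have : ({y : Gen h | R ≤ y.1 ∧ y.1 ⊓ x.1 = R} : Finset (Gen h)) = {x} := by
      ext y
      simp only [Finset.mem_filter, Finset.mem_univ, true_and, Finset.mem_singleton]
      constructor
      · rintro ⟨hy, -⟩
        rw [hxR] at hy
        exact (H.gen_eq_of_le hy).symm
      · rintro rfl
        exact ⟨hR, by rw [inf_idem, hxR]⟩
    rw [this]
    simp
  | succ e ih =>
    have hlt : R < x.1 := lt_of_le_of_ne hR fun h0 => by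
      have := H.finrank_coe x
      rw [← h0] at this
      omega
    obtain ⟨R', hRR', hR'x, hrk⟩ := exists_le_le_finrank_eq_add_one hlt
    have hR' := isTotallyIsotropic_of_le hR'x
    have hxp := H.le_perp_of_le hR'x
    -- By modularity the projection of `y` meets `x` in `R' ⊔ (y ⊓ x)`, so it meets `x` only in `R'`
    -- exactly when `y ⊓ x = R`. The exponents add up as `(2 * e + 1) + e ^ 2 = (e + 1) ^ 2`.
    have h3 := H.card_eq_mul_card_proj hRR' hrk hR' (P := fun y => y.1 ⊓ x.1 = R)
      (P' := fun y => y.1 ⊓ x.1 = R') fun y hRy hR'y => by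
        change _ ↔ (R' ⊔ (perp h R' ⊓ y.1)) ⊓ x.1 = R'
        have h5 : (R' ⊔ (perp h R' ⊓ y.1)) ⊓ x.1 = R' ⊔ (y.1 ⊓ x.1) := by
          rw [sup_inf_assoc_of_le _ hR'x, inf_comm (perp h R'), inf_assoc, inf_eq_right.2 hxp]
        rw [h5, sup_eq_left]
        constructor
        · intro h0
          rw [h0]
          exact hRR'
        · intro h0
          symm
          apply Submodule.eq_of_le_of_finrank_le (le_inf hRy hR)
          have h6 : y.1 ⊓ x.1 < R' := lt_of_le_of_ne h0 fun h7 =>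
            hR'y (h7 ▸ inf_le_left)
          have := Submodule.finrank_lt_finrank_of_lt h6
          omega
    have h4 : ({y : Gen h | R ≤ y.1 ∧ ¬ R' ≤ y.1 ∧ y.1 ⊓ x.1 = R} : Finset (Gen h)) =
        ({y : Gen h | R ≤ y.1 ∧ y.1 ⊓ x.1 = R} : Finset (Gen h)) := by
      ext y
      simp only [Finset.mem_filter, Finset.mem_univ, true_and]
      constructor
      · exact fun hy => ⟨hy.1, hy.2.2⟩
      · refine fun hy => ⟨hy.1, fun h0 => ?_, hy.2⟩
        have h5 : R' ≤ R := hy.2 ▸ le_inf h0 hR'x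
        have := Submodule.finrank_mono h5
        omega
    have h5 : (Finset.card {y : Gen h | R ≤ y.1 ∧ ¬ R' ≤ y.1 ∧ y.1 ⊓ x.1 = R} : ℝ) =
        (q : ℝ) ^ (2 * (d - finrank K R') + 1) *
          (Finset.card {y : Gen h | R' ≤ y.1 ∧ y.1 ⊓ x.1 = R'} : ℝ) := by
      convert h3
    rw [h4, ih hR'x (by omega)] at h5
    rw [h5, ← pow_add]
    congr 1
    rw [show d - finrank K R' = e by omega]
    ring

/-- The number of generators through `R` that are disjoint from the generator `x`. -/
theorem card_gen_disjoint (H : HermitianSpace q d h) {R : Submodule K V} (x : Gen h)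
    (hR : IsTotallyIsotropic h R) :
    (Finset.card {y : Gen h | R ≤ y.1 ∧ y.1 ⊓ x.1 = ⊥} : ℝ) =
      if R ⊓ x.1 = ⊥ then (q : ℝ) ^ (d - finrank K R) ^ 2 else 0 := by
  split_ifs with hRx
  · have hle := H.finrank_le hR
    -- A generator `y` through `R` is disjoint from `x` exactly when it meets the projection of `x`
    -- only in `R`, because that meet is `R ⊔ (y ⊓ x)`.
    rw [← H.card_gen_inf_eq (d - finrank K R) (H.proj hR x) (H.le_proj hR x) (by omega)]
    congr 2
    ext y
    simp only [Finset.mem_filter, Finset.mem_univ, true_and, and_congr_right_iff]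
    intro hRy
    have hyp := H.le_perp_of_le hRy
    have h1 : y.1 ⊓ (H.proj hR x).1 = R ⊔ (y.1 ⊓ x.1) := by
      change y.1 ⊓ (R ⊔ (perp h R ⊓ x.1)) = _
      rw [inf_comm, sup_inf_assoc_of_le _ hRy, inf_assoc, inf_comm x.1, ← inf_assoc,
        inf_eq_right.2 hyp]
    rw [h1, sup_eq_left]
    constructor
    · intro h0
      rw [h0]
      exact bot_le
    · intro h0
      rw [← le_bot_iff, ← hRx]
      exact le_inf h0 inf_le_right
  · rw [Nat.cast_eq_zero, Finset.card_eq_zero, Finset.filter_eq_empty_iff]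
    rintro y - ⟨hRy, hyx⟩
    exact hRx (le_bot_iff.1 (hyx ▸ inf_le_inf_right _ hRy))

end HermitianSpace

end CountingGenerators

open Matrix

/-! ### Triangular action on the filtration by pencils -/

section Triangular

variable {K V : Type*} [Field K] [AddCommGroup V] [Module K V] {σ : K →+* K}

/-- The indicator function of the set of generators through `R`. -/
noncomputable def pencil (h : V →ₛₗ[σ] V →ₗ[K] K) (R : Submodule K V) : Gen h → ℝ :=
  fun x => if R ≤ x.1 then 1 else 0

/-- The space spanned by the pencils of the totally isotropic subspaces of dimension less
than `r`. -/
noncomputable def pencilSpan (h : V →ₛₗ[σ] V →ₗ[K] K) (r : ℕ) : Submodule ℝ (Gen h → ℝ) :=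
  Submodule.span ℝ (pencil h '' {R | IsTotallyIsotropic h R ∧ finrank K R < r})

theorem pencil_mem_pencilSpan {h : V →ₛₗ[σ] V →ₗ[K] K} {R : Submodule K V} {r : ℕ}
    (hR : IsTotallyIsotropic h R) (hr : finrank K R < r) : pencil h R ∈ pencilSpan h r :=
  Submodule.subset_span ⟨R, ⟨hR, hr⟩, rfl⟩

theorem pencilSpan_mono (h : V →ₛₗ[σ] V →ₗ[K] K) : Monotone (pencilSpan h) := fun _ _ hab =>
  Submodule.span_mono (Set.image_mono fun _ hR => ⟨hR.1, hR.2.trans_le hab⟩)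

variable [Finite V]

/-- `M` acts on the filtration by pencils as a triangular matrix with diagonal `ν`. -/
def IsTriangular {h : V →ₛₗ[σ] V →ₗ[K] K} (M : Matrix (Gen h) (Gen h) ℝ) (ν : ℕ → ℝ) : Prop :=
  ∀ R, IsTotallyIsotropic h R →
    M *ᵥ pencil h R - ν (finrank K R) • pencil h R ∈ pencilSpan h (finrank K R)

namespace IsTriangular

variable {h : V →ₛₗ[σ] V →ₗ[K] K} {M N : Matrix (Gen h) (Gen h) ℝ} {ν μ : ℕ → ℝ}

theorem mulVec_mem (hM : IsTriangular M ν) {r : ℕ} {v : Gen h → ℝ} (hv : v ∈ pencilSpan h r) :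
    M *ᵥ v ∈ pencilSpan h r := by
  have hle : pencilSpan h r ≤ (pencilSpan h r).comap M.mulVecLin := by
    refine Submodule.span_le.2 ?_
    rintro _ ⟨R, ⟨hR, hr⟩, rfl⟩
    have h1 := pencilSpan_mono h hr.le (hM R hR)
    have h2 := add_mem h1 (Submodule.smul_mem _ (ν (finrank K R)) (pencil_mem_pencilSpan hR hr))
    rw [sub_add_cancel] at h2
    exact h2
  exact hle hv

/-- Extends the defining condition from single pencils to the whole layer: `M` acts on the quotient
of consecutive steps of the filtration as the scalar `ν r`. -/
theorem mulVec_sub_mem (hM : IsTriangular M ν) {r : ℕ} {v : Gen h → ℝ}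
    (hv : v ∈ pencilSpan h (r + 1)) : M *ᵥ v - ν r • v ∈ pencilSpan h r := by
  have hle : pencilSpan h (r + 1) ≤
      (pencilSpan h r).comap (M.mulVecLin - ν r • LinearMap.id) := by
    refine Submodule.span_le.2 ?_
    rintro _ ⟨R, ⟨hR, hr⟩, rfl⟩
    change M *ᵥ pencil h R - ν r • pencil h R ∈ pencilSpan h r
    rcases Nat.lt_succ_iff_lt_or_eq.1 hr with hlt | rfl
    · exact sub_mem (hM.mulVec_mem (pencil_mem_pencilSpan hR hlt))
        (Submodule.smul_mem _ _ (pencil_mem_pencilSpan hR hlt))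
    · exact hM R hR
  exact hle hv

theorem add (hM : IsTriangular M ν) (hN : IsTriangular N μ) : IsTriangular (M + N) (ν + μ) := by
  intro R hR
  have := add_mem (hM R hR) (hN R hR)
  rw [Matrix.add_mulVec, Pi.add_apply, add_smul]
  convert this using 1
  abel

theorem smul (hM : IsTriangular M ν) (a : ℝ) : IsTriangular (a • M) (a • ν) := by
  intro R hR
  have := Submodule.smul_mem _ a (hM R hR)
  rw [smul_sub, smul_smul] at this
  rwa [Matrix.smul_mulVec]

theorem one : IsTriangular (1 : Matrix (Gen h) (Gen h) ℝ) 1 := by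
  intro R _
  simp

theorem mul (hM : IsTriangular M ν) (hN : IsTriangular N μ) : IsTriangular (M * N) (ν * μ) := by
  intro R hR
  have h1 := hM.mulVec_mem (hN R hR)
  have h2 := Submodule.smul_mem _ (μ (finrank K R)) (hM R hR)
  have := add_mem h1 h2
  rw [Matrix.mulVec_sub, Matrix.mulVec_smul, smul_sub, sub_add_sub_cancel, smul_smul,
    mul_comm, Matrix.mulVec_mulVec] at this
  exact this

end IsTriangular

namespace HermitianSpace

variable {q d : ℕ} {h : V →ₛₗ[σ] V →ₗ[K] K} [Finite K]

/-- The pencil of a generator is the indicator of a single element, so the filtration exhausts the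
function space. -/
theorem pencilSpan_eq_top (H : HermitianSpace q d h) : pencilSpan h (d + 1) = ⊤ := by
  rw [eq_top_iff, ← (Pi.basisFun ℝ (Gen h)).span_eq, Submodule.span_le]
  rintro _ ⟨x, rfl⟩
  have h1 : (Pi.basisFun ℝ (Gen h)) x = pencil h x.1 := by
    ext y
    rw [Pi.basisFun_apply, Pi.single_apply, pencil]
    congr 1
    exact propext ⟨fun hy => hy ▸ le_rfl, fun hy => (H.gen_eq_of_le hy).symm⟩
  rw [h1]
  exact pencil_mem_pencilSpan x.2.prop (by rw [H.finrank_coe]; omega)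

/-- A symmetric triangular matrix with nonnegative diagonal is positive semidefinite. -/
theorem posSemidef_of_isTriangular (H : HermitianSpace q d h) {M : Matrix (Gen h) (Gen h) ℝ}
    {ν : ℕ → ℝ} (hM : M.IsHermitian) (hν : IsTriangular M ν) (hpos : ∀ r ≤ d, 0 ≤ ν r) :
    M.PosSemidef := by
  rw [hM.posSemidef_iff_eigenvalues_nonneg]
  intro j
  set v : Gen h → ℝ := (hM.eigenvectorBasis j).ofLp with hv
  have hMv : M *ᵥ v = hM.eigenvalues j • v := hM.mulVec_eigenvectorBasis j
  have hv0 : v ≠ 0 := by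
    intro h0
    have : hM.eigenvectorBasis j = 0 := by
      ext i
      exact congrFun h0 i
    exact hM.eigenvectorBasis.toBasis.ne_zero j (by simpa using this)
  -- Take the first step of the filtration containing the eigenvector. Modulo the preceding step `v`
  -- is nonzero and `M` acts as a scalar `ν r`, so the eigenvalue is `ν r`.
  have hex : ∃ r, v ∈ pencilSpan h r := ⟨d + 1, by rw [H.pencilSpan_eq_top]; trivial⟩
  have hr0 : Nat.find hex ≠ 0 := by
    intro h0
    have h1 := Nat.find_spec hex
    rw [h0] at h1
    simp only [pencilSpan, Nat.not_lt_zero, and_false, Set.ofPred_false, Set.image_empty,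
      Submodule.span_empty, Submodule.mem_bot] at h1
    exact hv0 h1
  obtain ⟨r, hr⟩ := Nat.exists_eq_succ_of_ne_zero hr0
  have hle : r ≤ d := by
    have : Nat.find hex ≤ d + 1 := Nat.find_min' hex (by rw [H.pencilSpan_eq_top]; trivial)
    omega
  have h1 := Nat.find_spec hex
  rw [hr] at h1
  have h2 := hν.mulVec_sub_mem h1
  have h3 : v ∉ pencilSpan h r := Nat.find_min hex (by omega)
  rw [hMv, ← sub_smul] at h2
  have h4 : hM.eigenvalues j - ν r = 0 := by
    by_contra hne
    exact h3 ((Submodule.smul_mem_iff _ hne).1 h2)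
  have := hpos r hle
  simp only [Pi.zero_apply]
  linarith

end HermitianSpace

end Triangular

/-! ### The hyperplane-counting matrix and its recurrence -/

section Operators

variable {K V : Type*} [Field K] [AddCommGroup V] [Module K V] {σ : K →+* K} [Finite V]

/-- The relation of meeting in a subspace of dimension `c`. -/
noncomputable def meetMatrix (h : V →ₛₗ[σ] V →ₗ[K] K) (c : ℕ) : Matrix (Gen h) (Gen h) ℝ :=
  .of fun x y => if finrank K ↥(x.1 ⊓ y.1) = c then 1 else 0

/-- The number of common subspaces of codimension one of two generators. -/
noncomputable def hyperplaneMatrix (h : V →ₛₗ[σ] V →ₗ[K] K) : Matrix (Gen h) (Gen h) ℝ :=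
  .of fun x y => (Finset.card {A : Submodule K V |
    (A ≤ x.1 ∧ finrank K A + 1 = finrank K x.1) ∧ A ≤ y.1} : ℝ)

/-- The all-ones matrix. -/
def allOnes (h : V →ₛₗ[σ] V →ₗ[K] K) : Matrix (Gen h) (Gen h) ℝ := .of fun _ _ => 1

theorem natCast_card_filter_and {α : Type*} [Fintype α] (p r : α → Prop) [DecidablePred p]
    [DecidablePred r] [DecidablePred fun a => p a ∧ r a] :
    (Finset.card {a : α | p a ∧ r a} : ℝ) =
      ∑ a : α with p a, if r a then (1 : ℝ) else 0 := by
  rw [← Finset.natCast_card_filter, Finset.filter_filter]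
  congr!

theorem hyperplaneMatrix_mulVec (h : V →ₛₗ[σ] V →ₗ[K] K) (f : Gen h → ℝ) (x : Gen h) :
    (hyperplaneMatrix h *ᵥ f) x =
      ∑ A : Submodule K V with A ≤ x.1 ∧ finrank K A + 1 = finrank K x.1,
        ∑ z : Gen h with A ≤ z.1, f z := by
  simp only [mulVec, dotProduct, hyperplaneMatrix, of_apply]
  simp_rw [Finset.sum_filter (fun z : Gen h => _ ≤ z.1)]
  rw [Finset.sum_comm]
  refine Finset.sum_congr rfl fun z _ => ?_
  rw [← Finset.filter_filter, Finset.natCast_card_filter, Finset.sum_mul]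
  refine Finset.sum_congr rfl fun A _ => ?_
  split_ifs <;> simp

namespace HermitianSpace

variable {q d : ℕ} {h : V →ₛₗ[σ] V →ₗ[K] K} [Finite K]

/-- The number of hyperplanes of the generator `x` meeting `y` in dimension `c`. -/
theorem card_hyperplanes_finrank_inf (H : HermitianSpace q d h) (x y : Gen h) (c : ℕ) :
    (Finset.card {A : Submodule K V | (A ≤ x.1 ∧ finrank K A + 1 = finrank K x.1) ∧
      finrank K ↥(A ⊓ y.1) = c} : ℝ) =
      gaussNum q (d - c) * meetMatrix h c x y +
        (gaussNum q d - gaussNum q (d - (c + 1))) * meetMatrix h (c + 1) x y := by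
  set T := x.1 ⊓ y.1 with hT
  have hAT : ∀ A ≤ x.1, A ⊓ y.1 = T ⊓ A := fun A hA => by
    rw [hT, inf_comm A, inf_comm x.1, inf_assoc, inf_eq_right.2 hA]
  have hrkx := H.finrank_coe x
  have hge := H.card_hyperplanes (T := T) (W := x.1) inf_le_left
  have hall := H.card_hyperplanes (T := ⊥) (W := x.1) bot_le
  simp only [bot_le, true_and, finrank_bot, Nat.sub_zero] at hall
  have hsplit := Finset.card_filter_add_card_filter_not
    (s := {A : Submodule K V | A ≤ x.1 ∧ finrank K A + 1 = finrank K x.1}) (fun A => T ≤ A)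
  have hge' : ({A ∈ ({A : Submodule K V | A ≤ x.1 ∧ finrank K A + 1 = finrank K x.1} :
      Finset (Submodule K V)) | T ≤ A} : Finset (Submodule K V)) =
      ({A : Submodule K V | T ≤ A ∧ A ≤ x.1 ∧ finrank K A + 1 = finrank K x.1} :
        Finset (Submodule K V)) := by
    ext A
    simp only [Finset.mem_filter, Finset.mem_univ, true_and]
    tauto
  rw [hge'] at hsplit
  have hsplit' := congrArg (Nat.cast (R := ℝ)) hsplit
  rw [Nat.cast_add, hge, hall] at hsplit'
  -- A hyperplane of `x` either contains `T = x ⊓ y` or cuts it in a subspace of codimension one, so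
  -- it meets `y` in dimension `finrank K T` or one less.
  have hval : ∀ A ∈ ({A : Submodule K V | A ≤ x.1 ∧ finrank K A + 1 = finrank K x.1} :
      Finset (Submodule K V)), finrank K ↥(A ⊓ y.1) + (if T ≤ A then 0 else 1) = finrank K T := by
    intro A hA
    simp only [Finset.mem_filter, Finset.mem_univ, true_and] at hA
    rw [hAT A hA.1]
    split_ifs with hTA
    · rw [inf_eq_left.2 hTA, add_zero]
    · have h1 : T ⊓ A < T := lt_of_le_of_ne inf_le_left fun h0 => hTA (inf_eq_left.1 h0)
      have h2 := Submodule.finrank_lt_finrank_of_lt h1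
      have h3 := Submodule.finrank_sup_add_finrank_inf_eq T A
      have h4 : finrank K ↥(T ⊔ A) ≤ finrank K x.1 :=
        Submodule.finrank_mono (sup_le inf_le_left hA.1)
      omega
  rw [← Finset.filter_filter, Finset.natCast_card_filter,
    ← Finset.sum_filter_add_sum_filter_not _ (fun A => T ≤ A)]
  have hs1 : ∑ A ∈ ({A : Submodule K V | A ≤ x.1 ∧ finrank K A + 1 = finrank K x.1} :
      Finset (Submodule K V)) with T ≤ A, (if finrank K ↥(A ⊓ y.1) = c then (1 : ℝ) else 0) =
      gaussNum q (d - c) * meetMatrix h c x y := by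
    rw [Finset.sum_congr rfl (g := fun _ => if finrank K T = c then (1 : ℝ) else 0),
      Finset.sum_const, hge', nsmul_eq_mul, hge, hrkx, meetMatrix, of_apply, ← hT]
    · by_cases hc : finrank K T = c
      · rw [hc]
      · simp [hc]
    · intro A hA
      have h1 := hval A (Finset.mem_filter.1 hA).1
      rw [if_pos (Finset.mem_filter.1 hA).2, add_zero] at h1
      rw [h1]
  have hs2 : ∑ A ∈ ({A : Submodule K V | A ≤ x.1 ∧ finrank K A + 1 = finrank K x.1} :
      Finset (Submodule K V)) with ¬ T ≤ A, (if finrank K ↥(A ⊓ y.1) = c then (1 : ℝ) else 0) =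
      (gaussNum q d - gaussNum q (d - (c + 1))) * meetMatrix h (c + 1) x y := by
    rw [Finset.sum_congr rfl (g := fun _ => if finrank K T = c + 1 then (1 : ℝ) else 0),
      Finset.sum_const, nsmul_eq_mul, eq_sub_of_add_eq' hsplit', hrkx, meetMatrix, of_apply, ← hT]
    · by_cases hc : finrank K T = c + 1
      · rw [hc]
      · simp [hc]
    · intro A hA
      have h1 := hval A (Finset.mem_filter.1 hA).1
      rw [if_neg (Finset.mem_filter.1 hA).2] at h1
      rw [← h1]
      simp
  rw [hs1, hs2]

/-- Of the `q + 1` generators through a hyperplane `A` of `x`, one meets `y` in one dimension more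
than `A` does and the other `q` in the same dimension. Writing `+ 1 = c` makes the first term vanish
at `c = 0`. -/
theorem hyperplaneMatrix_mul_apply (H : HermitianSpace q d h) (x y : Gen h) (c : ℕ) :
    (hyperplaneMatrix h * meetMatrix h c) x y =
      (Finset.card {A : Submodule K V | (A ≤ x.1 ∧ finrank K A + 1 = finrank K x.1) ∧
        finrank K ↥(A ⊓ y.1) + 1 = c} : ℝ) +
      q * (Finset.card {A : Submodule K V | (A ≤ x.1 ∧ finrank K A + 1 = finrank K x.1) ∧
        finrank K ↥(A ⊓ y.1) = c} : ℝ) := by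
  have h1 : (hyperplaneMatrix h * meetMatrix h c) x y =
      (hyperplaneMatrix h *ᵥ fun z => meetMatrix h c z y) x := rfl
  rw [h1, hyperplaneMatrix_mulVec, natCast_card_filter_and, natCast_card_filter_and,
    Finset.mul_sum, ← Finset.sum_add_distrib]
  refine Finset.sum_congr rfl fun A hA => ?_
  simp only [Finset.mem_filter, Finset.mem_univ, true_and, H.finrank_coe] at hA
  have h2 := H.card_gen_ge_finrank_inf (isTotallyIsotropic_of_le hA.1) hA.2 y c
  rw [natCast_card_filter_and] at h2
  simp only [meetMatrix, of_apply]
  rw [h2]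
  simp

theorem hyperplaneMatrix_mul_meetMatrix_zero (H : HermitianSpace q d h) :
    hyperplaneMatrix h * meetMatrix h 0 = (q * gaussNum q d) • meetMatrix h 0 +
      (q * (gaussNum q d - gaussNum q (d - 1))) • meetMatrix h 1 := by
  ext x y
  rw [H.hyperplaneMatrix_mul_apply, H.card_hyperplanes_finrank_inf]
  simp
  ring

theorem hyperplaneMatrix_mul_meetMatrix_succ (H : HermitianSpace q d h) (c : ℕ) :
    hyperplaneMatrix h * meetMatrix h (c + 1) = gaussNum q (d - c) • meetMatrix h c +
      (gaussNum q d - gaussNum q (d - (c + 1)) + q * gaussNum q (d - (c + 1))) •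
        meetMatrix h (c + 1) +
      (q * (gaussNum q d - gaussNum q (d - (c + 2)))) • meetMatrix h (c + 2) := by
  ext x y
  rw [H.hyperplaneMatrix_mul_apply, H.card_hyperplanes_finrank_inf]
  simp only [add_left_inj]
  rw [H.card_hyperplanes_finrank_inf]
  simp
  ring

/-- The error term is explicit: it is the sum of the pencils of all hyperplanes of `R`. At `x ≥ R`
there are `gaussNum q (finrank K R)` of these, which is the amount subtracted in the diagonal. -/
theorem hyperplaneMatrix_isTriangular (H : HermitianSpace q d h) :
    IsTriangular (hyperplaneMatrix h)
      (fun r => gaussNum q d + q * gaussNum q (d - r) - gaussNum q r) := by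
  intro R hR
  have key : hyperplaneMatrix h *ᵥ pencil h R -
      (gaussNum q d + q * gaussNum q (d - finrank K R) - gaussNum q (finrank K R)) • pencil h R =
      ∑ R' : Submodule K V with R' ≤ R ∧ finrank K R' + 1 = finrank K R, pencil h R' := by
    ext x
    have hrkx := H.finrank_coe x
    have hrkR := H.finrank_le hR
    simp only [Pi.sub_apply, Pi.smul_apply, hyperplaneMatrix_mulVec, Finset.sum_apply, smul_eq_mul]
    rw [sub_eq_iff_eq_add]
    simp only [pencil]
    simp_rw [← Finset.natCast_card_filter, Finset.filter_filter]
    by_cases hRx : R ≤ x.1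
    · have h1 : ({R' : Submodule K V | (R' ≤ R ∧ finrank K R' + 1 = finrank K R) ∧ R' ≤ x.1} :
          Finset (Submodule K V)) = ({R' : Submodule K V | ⊥ ≤ R' ∧ R' ≤ R ∧
            finrank K R' + 1 = finrank K R} : Finset (Submodule K V)) := by
        ext R'
        simp only [Finset.mem_filter, Finset.mem_univ, true_and, bot_le]
        exact ⟨fun h0 => h0.1, fun h0 => ⟨h0, h0.1.trans hRx⟩⟩
      rw [h1, H.card_hyperplanes bot_le, finrank_bot, Nat.sub_zero, if_pos hRx]
      have h2 : ∀ A ∈ ({A : Submodule K V | A ≤ x.1 ∧ finrank K A + 1 = finrank K x.1} :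
          Finset (Submodule K V)), (Finset.card {z : Gen h | A ≤ z.1 ∧ R ≤ z.1} : ℝ) =
          1 + (if R ≤ A then (q : ℝ) else 0) := by
        intro A hA
        simp only [Finset.mem_filter, Finset.mem_univ, true_and] at hA
        rw [hrkx] at hA
        have hAx := H.card_gen_ge (isTotallyIsotropic_of_le hA.1) hA.2 x hA.1
        split_ifs with hRA
        · have h3 : ({z : Gen h | A ≤ z.1 ∧ R ≤ z.1} : Finset (Gen h)) =
              insert x ({z : Gen h | A ≤ z.1 ∧ z ≠ x} : Finset (Gen h)) := by
            ext z
            simp only [Finset.mem_filter, Finset.mem_univ, true_and, Finset.mem_insert]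
            constructor
            · intro hz
              by_cases h0 : z = x
              · exact Or.inl h0
              · exact Or.inr ⟨hz.1, h0⟩
            · rintro (rfl | hz)
              · exact ⟨hA.1, hRx⟩
              · exact ⟨hz.1, hRA.trans hz.1⟩
          rw [h3, Finset.card_insert_of_notMem (by simp), hAx]
          push_cast
          ring
        · have h3 : ({z : Gen h | A ≤ z.1 ∧ R ≤ z.1} : Finset (Gen h)) = {x} := by
            ext z
            simp only [Finset.mem_filter, Finset.mem_univ, true_and, Finset.mem_singleton]
            constructor
            · intro hz
              have h4 : A ⊔ R = x.1 := by
                apply Submodule.eq_of_le_of_finrank_le (sup_le hA.1 hRx)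
                have h5 : A < A ⊔ R := lt_of_le_of_ne le_sup_left fun h0 =>
                  hRA (h0 ▸ le_sup_right)
                have := Submodule.finrank_lt_finrank_of_lt h5
                omega
              exact (H.gen_eq_of_le (h4 ▸ sup_le hz.1 hz.2)).symm
            · rintro rfl
              exact ⟨hA.1, hRx⟩
          rw [h3]
          simp
      rw [Finset.sum_congr rfl h2, Finset.sum_add_distrib, ← Finset.sum_filter, Finset.sum_const,
        Finset.sum_const, Finset.filter_filter]
      have h5 : ({A : Submodule K V | (A ≤ x.1 ∧ finrank K A + 1 = finrank K x.1) ∧ R ≤ A} :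
          Finset (Submodule K V)) = ({A : Submodule K V | R ≤ A ∧ A ≤ x.1 ∧
            finrank K A + 1 = finrank K x.1} : Finset (Submodule K V)) := by
        ext A
        simp only [Finset.mem_filter, Finset.mem_univ, true_and]
        tauto
      have hall := H.card_hyperplanes (T := ⊥) (W := x.1) bot_le
      simp only [bot_le, true_and, finrank_bot, Nat.sub_zero] at hall
      rw [h5, nsmul_eq_mul, nsmul_eq_mul, H.card_hyperplanes hRx, hall, hrkx]
      ring
    · rw [if_neg hRx, mul_zero, add_zero]
      have hrank := H.finrank_perp_inf R x
      have hlt : perp h R ⊓ x.1 < x.1 := lt_of_le_of_ne inf_le_right fun h0 => hRx <| by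
        have := H.le_perp_comm.1 (inf_eq_right.1 h0)
        rwa [H.perp_coe] at this
      have hlt2 : R ⊓ x.1 < R := lt_of_le_of_ne inf_le_left fun h0 => hRx (inf_eq_left.1 h0)
      have hl1 := Submodule.finrank_lt_finrank_of_lt hlt
      have hl2 := Submodule.finrank_lt_finrank_of_lt hlt2
      -- If `R ⊓ x` is a hyperplane of `R`, each side counts one object: `R ⊓ x` itself, and the
      -- projection of `x` through `perp h R ⊓ x`. Otherwise both counts are zero.
      by_cases hc : finrank K ↥(R ⊓ x.1) + 1 = finrank K R
      · have h1 : ({R' : Submodule K V | (R' ≤ R ∧ finrank K R' + 1 = finrank K R) ∧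
            R' ≤ x.1} : Finset (Submodule K V)) = {R ⊓ x.1} := by
          ext R'
          simp only [Finset.mem_filter, Finset.mem_univ, true_and, Finset.mem_singleton]
          constructor
          · rintro ⟨⟨h0, h2⟩, h3⟩
            exact Submodule.eq_of_le_of_finrank_eq (le_inf h0 h3) (by omega)
          · rintro rfl
            exact ⟨⟨inf_le_left, hc⟩, inf_le_right⟩
        rw [h1, Finset.sum_eq_single (perp h R ⊓ x.1)]
        · have h3 : ({z : Gen h | perp h R ⊓ x.1 ≤ z.1 ∧ R ≤ z.1} : Finset (Gen h)) =
              {H.proj hR x} := by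
            ext z
            simp only [Finset.mem_filter, Finset.mem_univ, true_and, Finset.mem_singleton]
            constructor
            · intro hz
              exact (H.gen_eq_of_le (sup_le hz.2 hz.1)).symm
            · rintro rfl
              exact ⟨H.perp_inf_le_proj hR x, H.le_proj hR x⟩
          rw [h3]
          simp
        · intro A hA hne
          simp only [Finset.mem_filter, Finset.mem_univ, true_and] at hA
          rw [Nat.cast_eq_zero, Finset.card_eq_zero, Finset.filter_eq_empty_iff]
          rintro z - ⟨hAz, hRz⟩
          exact hne (Submodule.eq_of_le_of_finrank_eq
            (le_inf (hAz.trans (H.le_perp_of_le hRz)) hA.1) (by omega))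
        · intro h0
          refine absurd ?_ h0
          simp only [Finset.mem_filter, Finset.mem_univ, true_and]
          exact ⟨inf_le_right, by omega⟩
      · rw [Finset.sum_eq_zero, eq_comm, Nat.cast_eq_zero, Finset.card_eq_zero,
          Finset.filter_eq_empty_iff]
        · rintro R' - ⟨⟨h0, h2⟩, h3⟩
          have := Submodule.finrank_mono (le_inf h0 h3)
          omega
        · intro A hA
          simp only [Finset.mem_filter, Finset.mem_univ, true_and] at hA
          rw [Nat.cast_eq_zero, Finset.card_eq_zero, Finset.filter_eq_empty_iff]
          rintro z - ⟨hAz, hRz⟩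
          have := Submodule.finrank_mono (le_inf (hAz.trans (H.le_perp_of_le hRz)) hA.1)
          omega
  rw [key]
  refine sum_mem fun R' hR' => ?_
  simp only [Finset.mem_filter, Finset.mem_univ, true_and] at hR'
  exact pencil_mem_pencilSpan (fun a ha b hb => hR a (hR'.1 ha) b (hR'.1 hb)) (by omega)

end HermitianSpace

end Operators

/-! ### The disjointness matrix and Möbius inversion over subspaces -/

section Disjointness

variable {K V : Type*} [Field K] [AddCommGroup V] [Module K V] {σ : K →+* K}

/-- The indicator function of the set of generators disjoint from `R`. -/
noncomputable def disjointFun (h : V →ₛₗ[σ] V →ₗ[K] K) (R : Submodule K V) : Gen h → ℝ :=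
  fun x => if R ⊓ x.1 = ⊥ then 1 else 0

theorem pencil_mul_pencil (h : V →ₛₗ[σ] V →ₗ[K] K) (R T : Submodule K V) :
    pencil h R * pencil h T = pencil h (R ⊔ T) := by
  ext x
  simp only [Pi.mul_apply, pencil, sup_le_iff]
  split_ifs <;> simp_all

variable [Finite V]

/-- The space spanned by the pencils of the proper subspaces of `R`. -/
noncomputable def properSpan (h : V →ₛₗ[σ] V →ₗ[K] K) (R : Submodule K V) :
    Submodule ℝ (Gen h → ℝ) :=
  Submodule.span ℝ (pencil h '' {T | T < R})

theorem properSpan_le_pencilSpan {h : V →ₛₗ[σ] V →ₗ[K] K} {R : Submodule K V}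
    (hR : IsTotallyIsotropic h R) : properSpan h R ≤ pencilSpan h (finrank K R) := by
  refine Submodule.span_le.2 ?_
  rintro _ ⟨T, hT, rfl⟩
  have hlt : T < R := hT
  exact pencil_mem_pencilSpan (fun a ha b hb => hR a (hlt.le ha) b (hlt.le hb))
    (Submodule.finrank_lt_finrank_of_lt hlt)

/-- Adjoining one vector to a proper subspace of a hyperplane `R₁` still leaves a proper subspace of
`R`. -/
theorem pencil_mul_mem_properSpan {h : V →ₛₗ[σ] V →ₗ[K] K} {R₁ R : Submodule K V} {v : V}
    (hR₁ : R₁ ≤ R) (hrk : finrank K R₁ + 1 = finrank K R) (hv : v ∈ R) {f : Gen h → ℝ}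
    (hf : f ∈ properSpan h R₁) : pencil h (K ∙ v) * f ∈ properSpan h R := by
  have hle : properSpan h R₁ ≤
      (properSpan h R).comap (LinearMap.mulLeft ℝ (pencil h (K ∙ v))) := by
    refine Submodule.span_le.2 ?_
    rintro _ ⟨T, hT, rfl⟩
    change pencil h (K ∙ v) * pencil h T ∈ properSpan h R
    rw [pencil_mul_pencil]
    refine Submodule.subset_span ⟨_, ?_, rfl⟩
    refine lt_of_le_of_ne (sup_le (by simpa using hv) (hT.le.trans hR₁)) fun h0 => ?_
    have h1 := Submodule.finrank_add_le_finrank_add_finrank (K ∙ v) T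
    rw [h0] at h1
    have h2 := finrank_span_le_card (R := K) ({v} : Set V)
    rw [Set.toFinset_card, Fintype.card_unique] at h2
    have h3 := Submodule.finrank_lt_finrank_of_lt hT
    omega
  exact hle hf

namespace HermitianSpace

variable {q d : ℕ} {h : V →ₛₗ[σ] V →ₗ[K] K} [Finite K]

theorem exists_hyperplane (H : HermitianSpace q d h) {R : Submodule K V} (hR : R ≠ ⊥) :
    ∃ R₁ ≤ R, finrank K R₁ + 1 = finrank K R := by
  have h1 : ∃ v, v ∉ perp h R := by
    by_contra! h0
    apply hR
    rw [← H.perp_perp R, ← le_bot_iff]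
    intro v hv
    exact H.form.nondegenerate.1 v fun w => H.ortho_comm.1 (hv w (h0 w))
  obtain ⟨v, hv⟩ := h1
  exact ⟨_, inf_le_left, H.finrank_inf_perp_span hv⟩

/-- If `x` misses `R₁`, it meets `R` in dimension at most one. When the meet is nonzero, its `q ^ 2
- 1` nonzero vectors all lie outside `R₁`; this accounts for the normalising factor. -/
theorem disjointFun_eq (H : HermitianSpace q d h) [Fintype V] {R₁ R : Submodule K V}
    (hR₁ : R₁ ≤ R) (hrk : finrank K R₁ + 1 = finrank K R) :
    disjointFun h R = disjointFun h R₁ - ((q : ℝ) ^ 2 - 1)⁻¹ •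
      ∑ v : V with v ∈ R ∧ v ∉ R₁, pencil h (K ∙ v) * disjointFun h R₁ := by
  have hq := H.one_lt_real
  have hQ : (q : ℝ) ^ 2 - 1 ≠ 0 := by nlinarith
  ext x
  simp only [Pi.sub_apply, Pi.smul_apply, Finset.sum_apply, Pi.mul_apply, ← Finset.sum_mul,
    smul_eq_mul]
  by_cases h1 : R₁ ⊓ x.1 = ⊥
  · have h2 : disjointFun h R₁ x = 1 := if_pos h1
    have h3 : ∑ v : V with v ∈ R ∧ v ∉ R₁, pencil h (K ∙ v) x =
        (q : ℝ) ^ (2 * finrank K ↥(R ⊓ x.1)) - 1 := by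
      have h4 := H.card_mem_not_mem (bot_le : ⊥ ≤ R ⊓ x.1)
      rw [finrank_bot, mul_zero, pow_zero] at h4
      rw [← h4]
      simp only [pencil, Submodule.span_singleton_le_iff_mem]
      rw [← Finset.natCast_card_filter, Finset.filter_filter]
      congr 2
      ext v
      simp only [Finset.mem_filter, Finset.mem_univ, true_and, Submodule.mem_inf,
        Submodule.mem_bot]
      constructor
      · rintro ⟨⟨hvR, hvR₁⟩, hvx⟩
        exact ⟨⟨hvR, hvx⟩, fun h0 => hvR₁ (h0 ▸ R₁.zero_mem)⟩
      · rintro ⟨⟨hvR, hvx⟩, hv0⟩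
        refine ⟨⟨hvR, fun h0 => hv0 ?_⟩, hvx⟩
        rw [← Submodule.mem_bot (R := K), ← h1]
        exact ⟨h0, hvx⟩
    rw [h2, h3, mul_one]
    have h5 := Submodule.finrank_sup_add_finrank_inf_eq R₁ (R ⊓ x.1)
    have h6 : R₁ ⊓ (R ⊓ x.1) = ⊥ := by
      rw [← inf_assoc, inf_eq_left.2 hR₁, h1]
    have h7 : finrank K ↥(R₁ ⊔ (R ⊓ x.1)) ≤ finrank K R :=
      Submodule.finrank_mono (sup_le hR₁ inf_le_left)
    rw [h6, finrank_bot] at h5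
    by_cases h8 : R ⊓ x.1 = ⊥
    · rw [h8, finrank_bot]
      simp [disjointFun, h8]
    · have h9 : finrank K ↥(R ⊓ x.1) ≠ 0 := fun h0 => h8 (Submodule.finrank_eq_zero.1 h0)
      have h10 : finrank K ↥(R ⊓ x.1) = 1 := by omega
      simp only [disjointFun, h8, if_false, h10]
      rw [mul_one, inv_mul_cancel₀ hQ, sub_self]
  · have h2 : disjointFun h R₁ x = 0 := if_neg h1
    have h3 : R ⊓ x.1 ≠ ⊥ := fun h0 => h1 (le_bot_iff.1 (h0 ▸ inf_le_inf_right _ hR₁))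
    rw [h2, mul_zero, mul_zero, sub_zero]
    exact if_neg h3

/-- The coefficient is the Möbius function of the subspace lattice over the field of order `q ^ 2`.
Passing from a hyperplane of dimension `r` to `R` multiplies it by `-(q ^ (2 * (r + 1)) - q ^ (2 *
r)) / (q ^ 2 - 1) = -q ^ (2 * r)`. -/
theorem disjointFun_sub_mem (H : HermitianSpace q d h) (r : ℕ) {R : Submodule K V}
    (hr : finrank K R = r) :
    disjointFun h R - ((-1) ^ r * (q : ℝ) ^ (r * (r - 1))) • pencil h R ∈ properSpan h R := by
  have := Fintype.ofFinite V
  have hq := H.one_lt_real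
  have hQ : (q : ℝ) ^ 2 - 1 ≠ 0 := by nlinarith
  induction r generalizing R with
  | zero =>
    rw [Submodule.finrank_eq_zero] at hr
    subst hr
    convert Submodule.zero_mem _
    ext x
    simp [disjointFun, pencil]
  | succ r ih =>
    obtain ⟨R₁, hR₁, hrk⟩ := H.exists_hyperplane (R := R) fun h0 => by
      rw [h0, finrank_bot] at hr
      omega
    set c : ℝ := (-1) ^ r * (q : ℝ) ^ (r * (r - 1)) with hc
    have ih₁ := ih (R := R₁) (by omega)
    set l := disjointFun h R₁ - c • pencil h R₁ with hl
    have hdis : disjointFun h R₁ = c • pencil h R₁ + l := by rw [hl]; abel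
    have hlt : R₁ < R := lt_of_le_of_ne hR₁ fun h0 => by rw [h0] at hrk; omega
    have hl' : l ∈ properSpan h R :=
      Submodule.span_mono (Set.image_mono fun T hT => lt_of_lt_of_le hT hR₁) ih₁
    have hp : pencil h R₁ ∈ properSpan h R := Submodule.subset_span ⟨R₁, hlt, rfl⟩
    have hterm : ∀ v ∈ ({v : V | v ∈ R ∧ v ∉ R₁} : Finset V),
        pencil h (K ∙ v) * disjointFun h R₁ = c • pencil h R + pencil h (K ∙ v) * l := by
      intro v hv
      simp only [Finset.mem_filter, Finset.mem_univ, true_and] at hv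
      have hsup : K ∙ v ⊔ R₁ = R := by
        rw [sup_comm]
        exact Submodule.eq_of_le_of_finrank_eq (sup_le hR₁ (by simpa using hv.1))
          (by rw [finrank_sup_span_singleton hv.2]; exact hrk)
      rw [hdis, mul_add, mul_smul_comm, pencil_mul_pencil, hsup]
    have hcoef : ((-1) ^ (r + 1) * (q : ℝ) ^ ((r + 1) * (r + 1 - 1))) =
        -(((q : ℝ) ^ 2 - 1)⁻¹ * (((q : ℝ) ^ (2 * (r + 1)) - (q : ℝ) ^ (2 * r)) * c)) := by
      have h1 : (r + 1) * (r + 1 - 1) = r * (r - 1) + 2 * r := by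
        cases r with
        | zero => rfl
        | succ n => simp only [Nat.add_sub_cancel]; ring
      rw [h1, hc]
      field_simp
      ring
    rw [H.disjointFun_eq hR₁ hrk, Finset.sum_congr rfl hterm, Finset.sum_add_distrib,
      Finset.sum_const, ← Nat.cast_smul_eq_nsmul ℝ, H.card_mem_not_mem hR₁, hcoef, hdis]
    rw [show finrank K R₁ = r by omega, hr]
    have hfin : c • pencil h R₁ + l - ((q : ℝ) ^ 2 - 1)⁻¹ •
        ∑ v : V with v ∈ R ∧ v ∉ R₁, pencil h (K ∙ v) * l ∈ properSpan h R := by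
      refine sub_mem (add_mem (Submodule.smul_mem _ _ hp) hl') (Submodule.smul_mem _ _ ?_)
      refine sum_mem fun v hv => ?_
      simp only [Finset.mem_filter, Finset.mem_univ, true_and] at hv
      exact pencil_mul_mem_properSpan hR₁ hrk hv.1 ih₁
    convert hfin using 1
    module

/-- Applied to the pencil of `R`, the matrix counts generators through `R` disjoint from `x`; this
is a constant multiple of `disjointFun h R`, whose leading coefficient is known. -/
theorem meetMatrix_zero_isTriangular (H : HermitianSpace q d h) :
    IsTriangular (meetMatrix h 0)
      (fun r => (-1) ^ r * (q : ℝ) ^ ((d - r) ^ 2 + r * (r - 1))) := by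
  intro R hR
  have h1 : meetMatrix h 0 *ᵥ pencil h R =
      (q : ℝ) ^ (d - finrank K R) ^ 2 • disjointFun h R := by
    ext x
    have h2 := H.card_gen_disjoint x hR
    simp only [Pi.smul_apply, smul_eq_mul, disjointFun, mul_ite, mul_one, mul_zero]
    rw [← h2, natCast_card_filter_and, Finset.sum_filter]
    simp only [mulVec, dotProduct, meetMatrix, of_apply, pencil]
    refine Finset.sum_congr rfl fun y _ => ?_
    simp only [Submodule.finrank_eq_zero, inf_comm y.1]
    split_ifs <;> simp
  have h3 := Submodule.smul_mem _ ((q : ℝ) ^ (d - finrank K R) ^ 2)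
    (properSpan_le_pencilSpan hR (H.disjointFun_sub_mem _ rfl))
  rw [h1]
  convert h3 using 1
  dsimp only
  rw [smul_sub, smul_smul, pow_add]
  congr 2
  ring

theorem allOnes_isTriangular (H : HermitianSpace q d h) :
    IsTriangular (allOnes h)
      (fun r => if r = 0 then ∏ i ∈ Finset.Icc 1 d, ((q : ℝ) ^ (2 * i - 1) + 1) else 0) := by
  intro R hR
  have hbot : IsTotallyIsotropic h ⊥ := fun a ha b _ => by
    rw [(Submodule.mem_bot K).1 ha]
    simp
  have h1 : allOnes h *ᵥ pencil h R = (∑ x, pencil h R x) • pencil h ⊥ := by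
    ext x
    simp [allOnes, mulVec, dotProduct, pencil]
  dsimp only
  rw [h1]
  split_ifs with hr
  · have hR0 : R = ⊥ := Submodule.finrank_eq_zero.1 hr
    have h2 := H.card_gen_through d hR (by omega)
    rw [Finset.natCast_card_filter] at h2
    subst hR0
    have h3 : ∑ x, pencil h ⊥ x = ∏ i ∈ Finset.Icc 1 d, ((q : ℝ) ^ (2 * i - 1) + 1) := h2
    rw [h3, sub_self]
    exact zero_mem _
  · rw [zero_smul, sub_zero]
    exact Submodule.smul_mem _ _ (pencil_mem_pencilSpan hbot (by rw [finrank_bot]; omega))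

end HermitianSpace

end Disjointness

/-! ### The diagonal of the matrix of generators meeting in a line -/

section MeetMatrices

variable {K V : Type*} [Field K] [AddCommGroup V] [Module K V] {σ : K →+* K} [Finite V]

/-- The diagonal of `meetMatrix h 2`, relative to that of `meetMatrix h 0`, as a function
of `w = q ^ (2 * r)`, where `u = q ^ d`. -/
noncomputable def meetTwoRatio (q u w : ℝ) : ℝ :=
  (-((q * u ^ 2 / w - w + u ^ 2 / q ^ 2 - u ^ 2 / q) * (w + (q - 1) * u ^ 2 - q * u ^ 2 / w)) /
    (q ^ 2 - 1) ^ 2 / (u ^ 2 / q) - (u ^ 2 - 1) / (q ^ 2 - 1)) / (u ^ 2 * (q ^ 2 + 1) / q ^ 3)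

theorem gaussNum_sub {q d r : ℕ} (hq : 1 < q) (hr : r ≤ d) :
    gaussNum q (d - r) = (((q : ℝ) ^ d) ^ 2 / (q : ℝ) ^ (2 * r) - 1) / ((q : ℝ) ^ 2 - 1) := by
  have hq0 : (q : ℝ) ≠ 0 := by
    have : (1 : ℝ) < q := by exact_mod_cast hq
    linarith
  rw [gaussNum]
  congr 2
  rw [eq_div_iff (by positivity), ← pow_add, ← pow_mul]
  congr 1
  omega

namespace HermitianSpace

variable {q d : ℕ} {h : V →ₛₗ[σ] V →ₗ[K] K} [Finite K]

/-- The top coefficients `ha1` and `ha2` of the recurrence are nonzero, so it can be solved for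
`meetMatrix h 1` and then `meetMatrix h 2`. Triangular matrices are closed under these operations,
and their diagonals multiply and add accordingly. -/
theorem meetMatrix_two_isTriangular (H : HermitianSpace q d h) (hd : 2 ≤ d) :
    ∃ ν : ℕ → ℝ, IsTriangular (meetMatrix h 2) ν ∧ ∀ r ≤ d, ν r =
      (-1) ^ r * (q : ℝ) ^ ((d - r) ^ 2 + r * (r - 1)) *
        meetTwoRatio q ((q : ℝ) ^ d) ((q : ℝ) ^ (2 * r)) := by
  have hq := H.one_lt_real
  have hQ : (q : ℝ) ^ 2 - 1 ≠ 0 := by nlinarith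
  have hq0 : (q : ℝ) ≠ 0 := by positivity
  have hu0 : (q : ℝ) ^ d ≠ 0 := by positivity
  have g0 := gaussNum_sub (d := d) H.one_lt (Nat.zero_le d)
  have g1 := gaussNum_sub (d := d) (r := 1) H.one_lt (by omega)
  have g2 := gaussNum_sub (d := d) (r := 2) H.one_lt (by omega)
  simp only [mul_zero, pow_zero, Nat.sub_zero, div_one] at g0
  norm_num at g1 g2
  set u : ℝ := (q : ℝ) ^ d with hu
  have ha1 : (q : ℝ) * (gaussNum q d - gaussNum q (d - 1)) = u ^ 2 / q := by
    rw [g0, g1]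
    field_simp
    ring
  have ha2 : (q : ℝ) * (gaussNum q d - gaussNum q (d - 2)) = u ^ 2 * ((q : ℝ) ^ 2 + 1) / q ^ 3 := by
    rw [g0, g2]
    field_simp
    ring
  have h0 := H.hyperplaneMatrix_mul_meetMatrix_zero
  have h1 := H.hyperplaneMatrix_mul_meetMatrix_succ 0
  simp only [zero_add, Nat.sub_zero] at h1
  rw [ha1] at h0
  rw [ha2] at h1
  have ha1' : u ^ 2 / (q : ℝ) ≠ 0 := by positivity
  have ha2' : u ^ 2 * ((q : ℝ) ^ 2 + 1) / q ^ 3 ≠ 0 := by positivity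
  have hA1 : meetMatrix h 1 = (u ^ 2 / (q : ℝ))⁻¹ • (hyperplaneMatrix h * meetMatrix h 0 +
      (-(q * gaussNum q d)) • meetMatrix h 0) := by
    rw [h0, neg_smul, add_neg_cancel_comm, smul_smul, inv_mul_cancel₀ ha1', one_smul]
  have hA2 : meetMatrix h 2 = (u ^ 2 * ((q : ℝ) ^ 2 + 1) / q ^ 3)⁻¹ •
      (hyperplaneMatrix h * meetMatrix h 1 +
        (-(gaussNum q d - gaussNum q (d - 1) + q * gaussNum q (d - 1))) • meetMatrix h 1 +
        (-gaussNum q d) • meetMatrix h 0) := by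
    rw [eq_inv_smul_iff₀ ha2', h1]
    module
  have T0 := H.meetMatrix_zero_isTriangular
  have TB := H.hyperplaneMatrix_isTriangular
  have T1 := ((TB.mul T0).add (T0.smul (-(q * gaussNum q d)))).smul (u ^ 2 / (q : ℝ))⁻¹
  rw [← hA1] at T1
  have T2 := (((TB.mul T1).add (T1.smul
    (-(gaussNum q d - gaussNum q (d - 1) + q * gaussNum q (d - 1))))).add
      (T0.smul (-gaussNum q d))).smul (u ^ 2 * ((q : ℝ) ^ 2 + 1) / q ^ 3)⁻¹
  rw [← hA2] at T2
  refine ⟨_, T2, fun r hr => ?_⟩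
  simp only [Pi.smul_apply, Pi.add_apply, Pi.mul_apply, smul_eq_mul]
  rw [gaussNum_sub H.one_lt hr, ← hu, g0, g1, show gaussNum q r =
    ((q : ℝ) ^ (2 * r) - 1) / ((q : ℝ) ^ 2 - 1) from rfl]
  have hw0 : (q : ℝ) ^ (2 * r) ≠ 0 := by positivity
  generalize (q : ℝ) ^ (2 * r) = w at *
  generalize (-1) ^ r * (q : ℝ) ^ ((d - r) ^ 2 + r * (r - 1)) = η
  rw [meetTwoRatio]
  field_simp
  ring

end HermitianSpace

end MeetMatrices

/-! ### Estimates and identities for the ratio and the weight -/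

section Estimates

variable {q u w : ℝ}

/-- The range of `w = q ^ (2 * r)` corresponds to `1 ≤ r ≤ d - 1`. In the proof `-X` and `Y` are `q
^ 2 - 1` times the diagonal of `hyperplaneMatrix h` shifted by the middle coefficients of the
recurrence at `c = 0` and `c = 1`. -/
theorem abs_meetTwoRatio_le (hq : 2 ≤ q) (hu : 0 < u) (hw : q ^ 2 ≤ w) (hwu : w ≤ u ^ 2 / q ^ 2) :
    |meetTwoRatio q u w| ≤ 1 := by
  have hq0 : 0 < q := by linarith
  have hw0 : 0 < w := by nlinarith
  have hQ : 0 < q ^ 2 - 1 := by nlinarith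
  have hu2 : 0 < u ^ 2 := by positivity
  have h1 : q * u ^ 2 / w ≤ u ^ 2 / q := by
    rw [div_le_div_iff₀ hw0 hq0]
    nlinarith
  have h1' : 0 < q * u ^ 2 / w := by positivity
  have h2 : u ^ 2 / q ≤ u ^ 2 / 2 := by gcongr
  have h3 : u ^ 2 / q ^ 2 ≤ u ^ 2 / q := by
    gcongr
    nlinarith
  have h5 : w ≤ u ^ 2 := by linarith
  set X := w + (q - 1) * u ^ 2 - q * u ^ 2 / w with hX
  set Y := q * u ^ 2 / w - w + u ^ 2 / q ^ 2 - u ^ 2 / q with hY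
  have hX1 : |X| ≤ q * u ^ 2 := by
    rw [abs_le]
    constructor <;> nlinarith
  have hY1 : |Y| ≤ u ^ 2 / q := by
    rw [abs_le]
    have : 0 < u ^ 2 / q ^ 2 := by positivity
    constructor <;> linarith
  have hXY : |Y * X| ≤ u ^ 4 := by
    rw [abs_mul]
    calc |Y| * |X| ≤ u ^ 2 / q * (q * u ^ 2) := by gcongr
      _ = u ^ 4 := by field_simp
  have hden : 0 < u ^ 2 * (q ^ 2 + 1) / q ^ 3 := by positivity
  rw [meetTwoRatio, abs_div, abs_of_pos hden, div_le_one hden]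
  have hA : |-(Y * X) / (q ^ 2 - 1) ^ 2 / (u ^ 2 / q)| ≤ q * u ^ 2 / (q ^ 2 - 1) ^ 2 := by
    rw [abs_div, abs_div, abs_neg, abs_of_pos (show 0 < (q ^ 2 - 1) ^ 2 by positivity),
      abs_of_pos (show 0 < u ^ 2 / q by positivity), div_div, div_le_div_iff₀ (by positivity)
      (by positivity)]
    calc |Y * X| * (q ^ 2 - 1) ^ 2 ≤ u ^ 4 * (q ^ 2 - 1) ^ 2 := by gcongr
      _ = q * u ^ 2 * ((q ^ 2 - 1) ^ 2 * (u ^ 2 / q)) := by field_simp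
  have hone : 1 ≤ u ^ 2 := by
    have : q ^ 2 * q ^ 2 ≤ u ^ 2 := by
      rw [← le_div_iff₀ (by positivity)]
      linarith
    nlinarith
  have hB : |(u ^ 2 - 1) / (q ^ 2 - 1)| ≤ u ^ 2 / (q ^ 2 - 1) := by
    rw [abs_div, abs_of_pos hQ, abs_of_nonneg (by linarith)]
    gcongr
    linarith
  refine (abs_sub _ _).trans ((add_le_add hA hB).trans ?_)
  have hC : q * u ^ 2 / (q ^ 2 - 1) ^ 2 + u ^ 2 / (q ^ 2 - 1) =
      u ^ 2 * ((q + q ^ 2 - 1) / (q ^ 2 - 1) ^ 2) := by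
    field_simp
    ring
  rw [hC, mul_div_assoc]
  refine mul_le_mul_of_nonneg_left ?_ hu2.le
  rw [div_le_div_iff₀ (by positivity) (by positivity)]
  -- The difference of the two sides is this term plus `q ^ 3 - q ^ 2 + 1`.
  have h6 : 0 ≤ q ^ 4 * (q - 2) * (q + 1) :=
    mul_nonneg (mul_nonneg (by positivity) (by linarith)) (by linarith)
  have h7 : q ^ 2 ≤ q ^ 3 := by gcongr <;> linarith
  nlinarith

/-- The weight of the relation of meeting in a line. -/
noncomputable def lineWeight (q u : ℝ) : ℝ :=
  u ^ 4 * (q ^ 2 - 1) * (q ^ 4 - 1) /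
    (q ^ 2 * (u + q) * ((u + q ^ 2) * (q ^ 2 * u ^ 2 - (q + 1) * u + q ^ 3)))

/-- The absolute value of the least diagonal entry of the weighted matrix, up to the factor
`q ^ (d * (d - 1))`. -/
noncomputable def leastRatio (q u : ℝ) : ℝ :=
  ((q + 1) * (q ^ 3 - 1) * u ^ 2 + q ^ 3 * (q ^ 2 - 1)) /
    ((u + q ^ 2) * (q ^ 2 * u ^ 2 - (q + 1) * u + q ^ 3))

theorem quadratic_pos (hq : 2 ≤ q) (hu : q ≤ u) :
    0 < q ^ 2 * u ^ 2 - (q + 1) * u + q ^ 3 := by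
  have h1 : 0 < u := by linarith
  have h2 : (q + 1) * u ≤ q ^ 2 * u ^ 2 := by
    rw [pow_two u, ← mul_assoc]
    apply mul_le_mul_of_nonneg_right _ h1.le
    nlinarith
  have h3 : 0 < q ^ 3 := by positivity
  linarith

theorem lineWeight_nonneg (hq : 2 ≤ q) (hu : q ≤ u) : 0 ≤ lineWeight q u := by
  have h1 := quadratic_pos hq hu
  have h2 : 0 < u := by linarith
  have h3 : 0 ≤ q ^ 2 - 1 := by nlinarith
  have h4 : 0 ≤ q ^ 4 - 1 := by nlinarith
  unfold lineWeight
  positivity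

theorem lineWeight_le (hq : 2 ≤ q) (hu : q ≤ u) : lineWeight q u ≤ q ^ 2 := by
  have h1 := quadratic_pos hq hu
  have h2 : 0 < u := by linarith
  have h3 : 0 ≤ q ^ 2 - 1 := by nlinarith
  have hq0 : 0 < q := by linarith
  unfold lineWeight
  rw [div_le_iff₀ (by positivity)]
  have h4 : q ^ 2 * u ^ 3 ≤ (u + q ^ 2) * (q ^ 2 * u ^ 2 - (q + 1) * u + q ^ 3) := by
    have h5 : q ^ 2 ≤ q ^ 4 - q - 1 := by nlinarith [mul_pos hq0 hq0]
    have h6 : q ^ 2 * u ≤ (q ^ 4 - q - 1) * u ^ 2 := by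
      rw [pow_two u, ← mul_assoc]
      apply mul_le_mul_of_nonneg_right _ h2.le
      nlinarith
    have h7 : 0 < q ^ 5 := by positivity
    nlinarith
  calc u ^ 4 * (q ^ 2 - 1) * (q ^ 4 - 1) ≤ u ^ 4 * q ^ 2 * q ^ 4 := by
        have h5 : 1 ≤ q ^ 4 := one_le_pow₀ (by linarith)
        gcongr <;> linarith
    _ = q ^ 2 * (q ^ 2 * u * (q ^ 2 * u ^ 3)) := by ring
    _ ≤ q ^ 2 * (q ^ 2 * (u + q) *
        ((u + q ^ 2) * (q ^ 2 * u ^ 2 - (q + 1) * u + q ^ 3))) := by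
        gcongr
        linarith

theorem leastRatio_pos (hq : 2 ≤ q) (hu : q ≤ u) : 0 < leastRatio q u := by
  have h1 := quadratic_pos hq hu
  have h2 : 0 < u := by linarith
  have h3 : 0 < q ^ 2 - 1 := by nlinarith
  have h4 : 0 < q ^ 3 - 1 := by nlinarith
  unfold leastRatio
  positivity

/-- With `u = q ^ d` this gives `Λ ≥ q ^ ((d - 1) ^ 2)`, the threshold that the intermediate
diagonal entries are compared with. -/
theorem le_leastRatio (hq : 2 ≤ q) (hu : q ≤ u) : q / u ≤ leastRatio q u := by
  have h1 := quadratic_pos hq hu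
  have h2 : 0 < u := by linarith
  have hq0 : 0 < q := by linarith
  unfold leastRatio
  rw [div_le_div_iff₀ h2 (by positivity)]
  have h4 : 4 ≤ q ^ 2 := by nlinarith
  have h5 : 0 ≤ q ^ 4 - q - 1 := by nlinarith
  have h6 : 0 ≤ (q ^ 4 - q - 1) * u ^ 2 * (u - q) :=
    mul_nonneg (by positivity) (by linarith)
  have h7 : 0 ≤ q ^ 5 * (u - q) := mul_nonneg (by positivity) (by linarith)
  nlinarith

theorem one_sub_lineWeight_mul_last (hq : 2 ≤ q) (hu : q ≤ u) :
    1 - lineWeight q u * meetTwoRatio q u (u ^ 2) = leastRatio q u := by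
  have h1 := (quadratic_pos hq hu).ne'
  have h2 : u ≠ 0 := by linarith
  have hq0 : q ≠ 0 := by linarith
  have h3 : q ^ 2 - 1 ≠ 0 := by nlinarith
  have h4 : u + q ^ 2 ≠ 0 := by nlinarith
  have h5 : u + q ≠ 0 := by linarith
  have h6 : q ^ 2 + 1 ≠ 0 := by positivity
  unfold lineWeight leastRatio meetTwoRatio
  generalize hc : q ^ 2 * u ^ 2 - (q + 1) * u + q ^ 3 = c at *
  field_simp
  rw [← hc]
  ring

/-- Together with `one_sub_lineWeight_mul_last` this explains the weight: it equalises the diagonal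
entries at `r = 1` and `r = d`, since `q ^ ((d - 1) ^ 2) * (u / q) = q ^ (d * (d - 1))`. -/
theorem one_sub_lineWeight_mul_first (hq : 2 ≤ q) (hu : q ≤ u) :
    1 - lineWeight q u * meetTwoRatio q u (q ^ 2) = u / q * leastRatio q u := by
  have h1 := (quadratic_pos hq hu).ne'
  have h2 : u ≠ 0 := by linarith
  have hq0 : q ≠ 0 := by linarith
  have h3 : q ^ 2 - 1 ≠ 0 := by nlinarith
  have h4 : u + q ^ 2 ≠ 0 := by nlinarith
  have h5 : u + q ≠ 0 := by linarith
  have h6 : q ^ 2 + 1 ≠ 0 := by positivity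
  unfold lineWeight leastRatio meetTwoRatio
  generalize hc : q ^ 2 * u ^ 2 - (q + 1) * u + q ^ 3 = c at *
  field_simp
  rw [← hc]
  ring

/-- Here `u * (1 - f ρ) + L` is the entry at `r = 0` after adding `Λ`, divided by `q ^ (d * (d -
1))`. The right-hand product contains the factors of the number of generators that are missing from
the final bound. -/
theorem one_sub_lineWeight_mul_zero (hq : 2 ≤ q) (hu : q ≤ u) :
    (u * (1 - lineWeight q u * meetTwoRatio q u 1) + leastRatio q u) *
      ((q ^ 2 + q + 1) * (u ^ 2 / q ^ 3) + 1) =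
      leastRatio q u * ((u ^ 2 / q + 1) * (u / q ^ 2 + 1) * (u + 1)) := by
  have h1 := (quadratic_pos hq hu).ne'
  have h2 : u ≠ 0 := by linarith
  have hq0 : q ≠ 0 := by linarith
  have h3 : q ^ 2 - 1 ≠ 0 := by nlinarith
  have h4 : u + q ^ 2 ≠ 0 := by nlinarith
  have h5 : u + q ≠ 0 := by linarith
  have h6 : q ^ 2 + 1 ≠ 0 := by positivity
  unfold lineWeight leastRatio meetTwoRatio
  generalize hc : q ^ 2 * u ^ 2 - (q + 1) * u + q ^ 3 = c at *
  field_simp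
  rw [← hc]
  ring

end Estimates

/-! ### Positive semidefiniteness and the ratio bound -/

section Bound

variable {K V : Type*} [Field K] [AddCommGroup V] [Module K V] {σ : K →+* K} [Finite V]

theorem prod_eq_mul_prod_filter {q d : ℕ} (hd : 5 ≤ d) (hodd : Odd d) :
    ∏ i ∈ Finset.Icc 1 d, ((q : ℝ) ^ (2 * i - 1) + 1) =
      ((q : ℝ) ^ (2 * d - 1) + 1) * ((q : ℝ) ^ (d - 2) + 1) * ((q : ℝ) ^ d + 1) *
        ∏ i ∈ (Finset.Icc 1 (d - 1)).filter (fun i => 2 * i ≠ d - 1 ∧ 2 * i ≠ d + 1),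
          ((q : ℝ) ^ (2 * i - 1) + 1) := by
  obtain ⟨m, rfl⟩ := hodd
  have h1 := Finset.prod_filter_mul_prod_filter_not (Finset.Icc 1 (2 * m))
    (fun i => 2 * i ≠ 2 * m + 1 - 1 ∧ 2 * i ≠ 2 * m + 1 + 1)
    (fun i => (q : ℝ) ^ (2 * i - 1) + 1)
  have h2 : (Finset.Icc 1 (2 * m)).filter
      (fun i => ¬ (2 * i ≠ 2 * m + 1 - 1 ∧ 2 * i ≠ 2 * m + 1 + 1)) = {m, m + 1} := by
    ext i
    simp only [Finset.mem_filter, Finset.mem_Icc, Finset.mem_insert, Finset.mem_singleton]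
    omega
  rw [h2, Finset.prod_pair (by omega)] at h1
  rw [Finset.prod_Icc_succ_top (by omega), ← h1]
  simp only [Nat.add_sub_cancel]
  rw [show 2 * m + 1 - 2 = 2 * m - 1 by omega, show 2 * (m + 1) - 1 = 2 * m + 1 by omega]
  ring

/-- Equality holds at `d = 5`, `r = 4`, and the inequality fails at `d = 4`, `r = 3`. The slack `3`
absorbs the factor `1 + q ^ 2 ≤ q ^ 3` coming from the weight. -/
theorem exponent_le {d r : ℕ} (hd : 5 ≤ d) (hr : 2 ≤ r) (hrd : r < d) :
    (d - r) ^ 2 + r * (r - 1) + 3 ≤ (d - 1) ^ 2 := by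
  obtain ⟨a, rfl⟩ := Nat.exists_eq_add_of_le hr
  obtain ⟨b, rfl⟩ := Nat.exists_eq_add_of_lt hrd
  rw [show 2 + a + b + 1 - (2 + a) = b + 1 by omega, show 2 + a - 1 = a + 1 by omega,
    show 2 + a + b + 1 - 1 = a + b + 2 by omega]
  have : 2 ≤ a + b := by omega
  nlinarith [Nat.zero_le (a * b)]

namespace HermitianSpace

variable {q d : ℕ} {h : V →ₛₗ[σ] V →ₗ[K] K} [Finite K]

/-- Equality holds at `r = 1` and `r = d`, where the sign is negative because `d` is odd. In
between, the entry has absolute value at most `q ^ ((d - 1) ^ 2)`, which does not exceed `Λ`. -/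
theorem diagonal_ge (hq : 2 ≤ q) (hd : 5 ≤ d) (hodd : Odd d) {r : ℕ} (hr : 1 ≤ r) (hrd : r ≤ d) :
    0 ≤ (-1) ^ r * (q : ℝ) ^ ((d - r) ^ 2 + r * (r - 1)) *
      (1 - lineWeight q ((q : ℝ) ^ d) * meetTwoRatio q ((q : ℝ) ^ d) ((q : ℝ) ^ (2 * r))) +
        (q : ℝ) ^ (d * (d - 1)) * leastRatio q ((q : ℝ) ^ d) := by
  have hqr : (2 : ℝ) ≤ q := by exact_mod_cast hq
  have hq0 : (0 : ℝ) < q := by linarith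
  have hqu : (q : ℝ) ≤ (q : ℝ) ^ d := le_self_pow₀ (by linarith) (by omega)
  have hu0 : (0 : ℝ) < (q : ℝ) ^ d := by positivity
  have hsq : (q : ℝ) ^ (d * (d - 1)) = (q : ℝ) ^ (d - 1) ^ 2 * ((q : ℝ) ^ d / q) := by
    rw [eq_comm, ← mul_div_assoc, div_eq_iff hq0.ne', ← pow_add, ← pow_succ]
    congr 1
    obtain ⟨e, rfl⟩ := Nat.exists_eq_add_of_le (show 1 ≤ d by omega)
    rw [Nat.add_sub_cancel_left]
    ring
  rcases eq_or_lt_of_le hrd with rfl | hrd'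
  · have h1 : (q : ℝ) ^ (2 * r) = ((q : ℝ) ^ r) ^ 2 := by rw [← pow_mul, mul_comm]
    rw [h1, one_sub_lineWeight_mul_last hqr hqu, hodd.neg_one_pow, Nat.sub_self]
    simp
  rcases eq_or_lt_of_le hr with rfl | hr'
  · rw [mul_one, one_sub_lineWeight_mul_first hqr hqu, hsq]
    simp only [Nat.sub_self, mul_zero, add_zero, pow_one]
    apply le_of_eq
    ring
  · set u : ℝ := (q : ℝ) ^ d with hu
    set w : ℝ := (q : ℝ) ^ (2 * r) with hw
    have hw1 : (q : ℝ) ^ 2 ≤ w := pow_le_pow_right₀ (by linarith) (by omega)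
    have hw2 : w ≤ u ^ 2 / (q : ℝ) ^ 2 := by
      rw [le_div_iff₀ (by positivity), hw, hu, ← pow_mul, ← pow_add]
      exact pow_le_pow_right₀ (by linarith) (by omega)
    have h1 := abs_meetTwoRatio_le hqr hu0 hw1 hw2
    have h2 := lineWeight_le hqr hqu
    have h3 := lineWeight_nonneg hqr hqu
    have h4 : |1 - lineWeight q u * meetTwoRatio q u w| ≤ (q : ℝ) ^ 3 := by
      have h5 : |lineWeight q u * meetTwoRatio q u w| ≤ (q : ℝ) ^ 2 := by
        rw [abs_mul, abs_of_nonneg h3]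
        nlinarith [abs_nonneg (meetTwoRatio q u w)]
      have h6 := abs_sub (1 : ℝ) (lineWeight q u * meetTwoRatio q u w)
      rw [abs_one] at h6
      nlinarith
    have h7 : |(-1) ^ r * (q : ℝ) ^ ((d - r) ^ 2 + r * (r - 1)) *
        (1 - lineWeight q u * meetTwoRatio q u w)| ≤ (q : ℝ) ^ (d - 1) ^ 2 := by
      rw [abs_mul, abs_mul, abs_pow, abs_neg, abs_one, one_pow, one_mul,
        abs_of_pos (show (0 : ℝ) < (q : ℝ) ^ ((d - r) ^ 2 + r * (r - 1)) by positivity)]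
      calc (q : ℝ) ^ ((d - r) ^ 2 + r * (r - 1)) * |1 - lineWeight q u * meetTwoRatio q u w| ≤
            (q : ℝ) ^ ((d - r) ^ 2 + r * (r - 1)) * (q : ℝ) ^ 3 := by gcongr
        _ = (q : ℝ) ^ ((d - r) ^ 2 + r * (r - 1) + 3) := by rw [← pow_add]
        _ ≤ (q : ℝ) ^ (d - 1) ^ 2 := pow_le_pow_right₀ (by linarith) (exponent_le hd hr' hrd')
    have h8 : (q : ℝ) ^ (d - 1) ^ 2 ≤ (q : ℝ) ^ (d * (d - 1)) * leastRatio q u := by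
      rw [hsq]
      calc (q : ℝ) ^ (d - 1) ^ 2 = (q : ℝ) ^ (d - 1) ^ 2 * (u / q) * (q / u) := by field_simp
        _ ≤ _ := by
          gcongr
          exact le_leastRatio hqr hqu
    have h9 := (abs_le.1 h7).1
    linarith

theorem meetMatrix_isHermitian (h : V →ₛₗ[σ] V →ₗ[K] K) (c : ℕ) :
    (meetMatrix h c).IsHermitian := by
  ext x y
  have hxy : finrank K ↥(y.1 ⊓ x.1) = finrank K ↥(x.1 ⊓ y.1) := by rw [inf_comm]
  simp [meetMatrix, hxy]

theorem allOnes_isHermitian (h : V →ₛₗ[σ] V →ₗ[K] K) : (allOnes h).IsHermitian := by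
  ext x y
  simp [allOnes]

theorem isHermitian_real_smul {n : Type*} {A : Matrix n n ℝ} (hA : A.IsHermitian) (a : ℝ) :
    (a • A).IsHermitian := by
  rw [Matrix.IsHermitian, conjTranspose_smul, hA.eq, star_trivial]

/-- The ratio bound for a weighted disjointness matrix `A₀ - f A₂` whose least eigenvalue
is `-Λ`. -/
theorem card_mul_le_of_posSemidef (H : HermitianSpace q d h) (hd : 0 < d) {f Λ β : ℝ}
    (hf : 0 ≤ f) (hΛ : 0 ≤ Λ)
    (hM : (meetMatrix h 0 + -f • meetMatrix h 2 + Λ • 1 + -β • allOnes h).PosSemidef)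
    (S : Finset (Gen h)) (hS : ∀ x ∈ S, ∀ y ∈ S, x ≠ y → x.1 ⊓ y.1 ≠ ⊥) :
    β * S.card ≤ Λ := by
  set M := meetMatrix h 0 + -f • meetMatrix h 2 + Λ • 1 + -β • allOnes h with hMdef
  have hquad := hM.dotProduct_mulVec_nonneg (fun x => if x ∈ S then (1 : ℝ) else 0)
  have hsum : star (fun x => if x ∈ S then (1 : ℝ) else 0) ⬝ᵥ
      (M *ᵥ fun x => if x ∈ S then (1 : ℝ) else 0) = ∑ x ∈ S, ∑ y ∈ S, M x y := by
    simp [dotProduct, mulVec]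
  rw [hsum] at hquad
  -- On `S` the disjointness matrix vanishes, also on the diagonal because generators have dimension
  -- `d > 0`, and the term with `-f` only lowers entries.
  have hentry : ∀ x ∈ S, ∀ y ∈ S, M x y ≤ (if x = y then Λ else 0) - β := by
    intro x hx y hy
    have h0 : meetMatrix h 0 x y = 0 := by
      simp only [meetMatrix, of_apply]
      rw [if_neg]
      rw [Submodule.finrank_eq_zero]
      by_cases hxy : x = y
      · subst hxy
        intro h1
        have h2 := H.finrank_coe x
        rw [inf_idem] at h1
        rw [h1, finrank_bot] at h2
        omega
      · exact hS x hx y hy hxy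
    have h2 : 0 ≤ meetMatrix h 2 x y := by
      simp only [meetMatrix, of_apply]
      split_ifs <;> norm_num
    have h3 := mul_nonneg hf h2
    simp only [hMdef, Matrix.add_apply, Matrix.smul_apply, smul_eq_mul, Matrix.one_apply, h0,
      allOnes, of_apply, mul_ite, mul_one, mul_zero]
    linarith
  have hle : ∑ x ∈ S, ∑ y ∈ S, M x y ≤ Λ * S.card - β * S.card ^ 2 := by
    refine (Finset.sum_le_sum fun x hx => Finset.sum_le_sum fun y hy => hentry x hx y hy).trans ?_
    apply le_of_eq
    simp only [Finset.sum_sub_distrib, Finset.sum_ite_eq, Finset.sum_const, nsmul_eq_mul,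
      Finset.sum_ite_mem, Finset.inter_self]
    ring
  rcases (Nat.cast_nonneg (α := ℝ) S.card).eq_or_lt with h0 | h0
  · rw [← h0, mul_zero]
    exact hΛ
  · have h1 : 0 ≤ (Λ - β * S.card) * S.card := by nlinarith
    have h2 := nonneg_of_mul_nonneg_left h1 h0
    linarith

/-- The weighted Hoffman bound for the disjointness relation on generators. -/
theorem card_le_of_pairwise (H : HermitianSpace q d h) (hd : 5 ≤ d) (hodd : Odd d)
    (S : Finset (Gen h)) (hS : ∀ x ∈ S, ∀ y ∈ S, x ≠ y → x.1 ⊓ y.1 ≠ ⊥) :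
    (S.card : ℝ) ≤ (((q : ℝ) ^ 2 + q + 1) * (q : ℝ) ^ (2 * d - 3) + 1) *
      ∏ i ∈ (Finset.Icc 1 (d - 1)).filter (fun i => 2 * i ≠ d - 1 ∧ 2 * i ≠ d + 1),
        ((q : ℝ) ^ (2 * i - 1) + 1) := by
  have hq : 2 ≤ q := H.one_lt
  have hqr : (2 : ℝ) ≤ q := by exact_mod_cast hq
  have hq0 : (0 : ℝ) < q := by linarith
  have hqu : (q : ℝ) ≤ (q : ℝ) ^ d := le_self_pow₀ (by linarith) (by omega)
  have hu0 : (0 : ℝ) < (q : ℝ) ^ d := by positivity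
  have hprod := prod_eq_mul_prod_filter (q := q) hd hodd
  have hP0 : 0 < ∏ i ∈ (Finset.Icc 1 (d - 1)).filter
      (fun i => 2 * i ≠ d - 1 ∧ 2 * i ≠ d + 1), ((q : ℝ) ^ (2 * i - 1) + 1) :=
    Finset.prod_pos fun i _ => by positivity
  generalize ∏ i ∈ (Finset.Icc 1 (d - 1)).filter (fun i => 2 * i ≠ d - 1 ∧ 2 * i ≠ d + 1),
    ((q : ℝ) ^ (2 * i - 1) + 1) = P at hprod hP0 ⊢
  have e1 : (q : ℝ) ^ (2 * d - 3) = ((q : ℝ) ^ d) ^ 2 / (q : ℝ) ^ 3 := by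
    rw [eq_div_iff (by positivity), ← pow_mul, ← pow_add]
    congr 1
    omega
  have e2 : (q : ℝ) ^ (2 * d - 1) = ((q : ℝ) ^ d) ^ 2 / q := by
    rw [eq_div_iff (by positivity), ← pow_mul, ← pow_succ]
    congr 1
    omega
  have e3 : (q : ℝ) ^ (d - 2) = (q : ℝ) ^ d / (q : ℝ) ^ 2 := by
    rw [eq_div_iff (by positivity), ← pow_add]
    congr 1
    omega
  rw [e2, e3] at hprod
  rw [e1]
  have key := one_sub_lineWeight_mul_zero hqr hqu
  have hf0 := lineWeight_nonneg hqr hqu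
  have hL0 := leastRatio_pos hqr hqu
  obtain ⟨ν, hν, hνr⟩ := H.meetMatrix_two_isTriangular (by omega)
  have hdiag : ∀ r, 1 ≤ r → r ≤ d → _ := fun r => diagonal_ge hq hd hodd
  have hexp : (q : ℝ) ^ ((d - 0) ^ 2 + 0 * (0 - 1)) = (q : ℝ) ^ (d * (d - 1)) * (q : ℝ) ^ d := by
    rw [← pow_add]
    congr 1
    obtain ⟨e, rfl⟩ := Nat.exists_eq_add_of_le (show 1 ≤ d by omega)
    rw [Nat.add_sub_cancel_left]
    simp
    ring
  have hE0 : (0 : ℝ) < (q : ℝ) ^ (d * (d - 1)) := by positivity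
  have hC0 : 0 < ((q : ℝ) ^ 2 + q + 1) * (((q : ℝ) ^ d) ^ 2 / (q : ℝ) ^ 3) + 1 := by positivity
  generalize ((q : ℝ) ^ 2 + q + 1) * (((q : ℝ) ^ d) ^ 2 / (q : ℝ) ^ 3) + 1 = C at key hC0 ⊢
  generalize lineWeight q ((q : ℝ) ^ d) = f at *
  generalize leastRatio q ((q : ℝ) ^ d) = L at *
  -- `β = Λ / (C * P)`, with `C * P` the claimed bound, makes the diagonal entry at `r = 0` exactly
  -- zero. For `r ≥ 1` the all-ones matrix contributes nothing to the diagonal.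
  have hT := (((H.meetMatrix_zero_isTriangular.add (hν.smul (-f))).add
    (IsTriangular.one.smul ((q : ℝ) ^ (d * (d - 1)) * L))).add
      (H.allOnes_isTriangular.smul (-((q : ℝ) ^ (d * (d - 1)) * L / (C * P)))))
  have hpsd := H.posSemidef_of_isTriangular
    ((((meetMatrix_isHermitian h 0).add (isHermitian_real_smul (meetMatrix_isHermitian h 2) _)).add
      (isHermitian_real_smul isHermitian_one _)).add
      (isHermitian_real_smul (allOnes_isHermitian h) _)) hT (by
    intro r hr
    simp only [Pi.add_apply, Pi.smul_apply, smul_eq_mul, Pi.one_apply, mul_one]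
    rw [hνr r hr]
    rcases Nat.eq_zero_or_pos r with rfl | hr0
    · rw [if_pos rfl, hprod, hexp]
      simp only [pow_zero, one_mul, mul_zero]
      generalize (q : ℝ) ^ (d * (d - 1)) = E at *
      apply le_of_eq
      rw [eq_comm, neg_mul (E * L / (C * P)), ← sub_eq_add_neg, sub_eq_zero, div_mul_eq_mul_div,
        eq_div_iff (by positivity)]
      linear_combination E * P * key
    · rw [if_neg (by omega)]
      have := hdiag r hr0 hr
      linarith)
  have h2 := H.card_mul_le_of_posSemidef (by omega) hf0 (by positivity) hpsd S hS
  rw [div_mul_eq_mul_div, div_le_iff₀ (by positivity)] at h2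
  exact le_of_mul_le_mul_left h2 (by positivity)

end HermitianSpace

end Bound

end HermitianPolar

theorem theorem1 {K V : Type*} [Field K] [Finite K] [AddCommGroup V] [Module K V]
    (q d : ℕ) (hd : 5 ≤ d) (hodd : Odd d)
    (hK : Nat.card K = q ^ 2) (hV : Module.finrank K V = 2 * d)
    {σ : K →+* K} (h : V →ₛₗ[σ] V →ₗ[K] K) (hh : IsHermitianPolarForm q h)
    (S : Set (Submodule K V)) (hS : IsErdosKoRadoSet h S) :
    S.Finite ∧
      S.ncard ≤ ((q ^ 2 + q + 1) * q ^ (2 * d - 3) + 1) *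
        ∏ i ∈ (Finset.Icc 1 (d - 1)).filter (fun i => 2 * i ≠ d - 1 ∧ 2 * i ≠ d + 1),
          (q ^ (2 * i - 1) + 1) := by
  classical
  -- `finrank` is zero in infinite dimension, so `2 * d > 0` already forces `V` to be
  -- finite-dimensional, hence finite.
  have : Module.Finite K V := Module.finite_of_finrank_pos (by omega)
  have : Finite V := Module.finite_of_finite K
  have H : HermitianPolar.HermitianSpace q d h := ⟨hK, hV, hh⟩
  have hfin : S.Finite := S.toFinite
  refine ⟨hfin, ?_⟩
  let T : Finset (HermitianPolar.Gen h) := hfin.toFinset.subtype (IsGenerator h)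
  have hT : T.card = S.ncard := by
    rw [Set.ncard_eq_toFinset_card S hfin, Finset.card_subtype, Finset.filter_true_of_mem]
    intro x hx
    exact hS.1 x (hfin.mem_toFinset.1 hx)
  have hb := H.card_le_of_pairwise hd hodd T fun x hx y hy hxy =>
    hS.2 (by simpa [T] using hx) (by simpa [T] using hy) fun h0 => hxy (Subtype.ext h0)
  rw [hT] at hb
  exact_mod_cast hb
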